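/- **Conventions.** For a finite poset $P$, a $P$-partition is a map $\sigma:P\to\mathbb N=\{0,1,2,\dots\}$ such that $x\le y$ implies $\sigma(x)\ge\sigma(y)$; its size is $|\sigma|=\sum_{x\in P}\sigma(x)$. For $k\ge 3$ the double-tailed diamond $d_k(1)$ is the poset with $2k-2$ elements obtained from a diamond (top $z$, bottom $w$, two incomparable sides $x,y$) by attaching a chain with $k-3$ elements above $z$ and a chain with $k-3$ elements below $w$. The $k-2$ elements above the two sides are its neck elements. An interval of $P$ isomorphic to $d_k(1)$ is a $d_k$-interval, and a convex subset of $P$ isomorphic to $d_k(1)$ without its maximal element is a $d_k^-$-convex set. The poset $P$ is $d$-complete if for every $k\ge3$: (1) for each $d_k^-$-convex set $I$ there is an element $z$ covering the maximal element(s) of $I$ such that $I\cup\{z\}$ is a $d_k$-interval; (2) if $[w,z]$ is a $d_k$-interval, then $z$ covers no element outside $[w,z]$; (3) no two distinct $d_k^-$-convex sets differ only in their minimal elements. The hook lengths $h(z)$ of the elements of a $d$-complete poset are defined recursively: if $z$ is not in the neck of any $d_k$-interval, then $h(z)=|\{y\in P: y\le z\}|$; otherwise there is a unique $w$ such that $[w,z]$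 is a $d_l$-interval for some $l$, and $h(z)=h(x)+h(y)-h(w)$, where $x,y$ are the two incomparable elements of $[w,z]$. For a partition $\lambda=(\lambda_1\ge\dots\ge\lambda_r\ge0)$ let $S_r(\lambda)$ be the shifted diagram whose $i$-th row ($1\le i\le r$) has $\lambda_i+r+1-i$ cells and is shifted by $i-1$ units to the right, viewed as a poset in which smaller elements lie weakly below and weakly to the right. Let $X$ be a finite family of triples $(\lambda,r,s)$ with $\lambda$ a partition with at most $r$ nonzero parts, $r,s\ge1$ and $s+r-1\le n$. The poset $P_n(X)$ is obtained from a chain $x_1<\dots<x_n$ by gluing, for each $(\lambda,r,s)\in X$, a copy of $S_r(\lambda)$ to it, the diagonal cells of $S_r(\lambda)$ from top to bottom being identified with $x_{s+r-1},x_{s+r-2},\dots,x_s$. The poset $P_n^m(X)$ is obtained from $P_n(X)$ by attaching a chain with $m$ elements above $x_n$. **Theorem.** Let $\lambda=(\lambda_1\ge\lambda_2\ge\lambda_3\ge\lambda_4\ge\lambda_5\ge0)$ be a partition with at most five nonzero parts, and let $P=P_6^{\lambda_1+4}(X)$ with $$X=\{(\lambda,5,1),(\emptyset,3,1),(\emptyset,2,3),(\emptyset,3,4),(\emptyset,2,5)\}$$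 (a swivel with six diagonal elements). Then $P$ is $d$-complete, its hook lengths are well defined, and $P$ has the hook length property: as formal power series in $q$, $$\sum_{\sigma}q^{|\sigma|}=\prod_{x\in P}\frac{1}{1-q^{h(x)}},$$ where the sum is over all $P$-partitions $\sigma$. -/

import Mathlib

open PowerSeries

/-! ### `P`-partitions -/

/-- The generating function `∑_σ q ^ |σ|` over all `P`-partitions `σ` of a finite poset `P`, as a
formal power series in `q`. A `P`-partition is a map `σ : P → ℕ` such that `x ≤ y` implies
`σ x ≥ σ y`, and its size is `|σ| = ∑ x, σ x`. -/
noncomputable def partitionGF (P : Type*) [PartialOrder P] [Fintype P] : ℤ⟦X⟧ :=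
  PowerSeries.mk fun N => (Nat.card {σ : P → ℕ // Antitone σ ∧ ∑ x, σ x = N} : ℤ)

/-! ### Double-tailed diamonds and `d`-complete posets -/

/-- The double-tailed diamond `d_k(1)` (for `k ≥ 3`): the `2k - 2` elements
`0 < 1 < ⋯ < 2k - 3`, except that the two middle elements `k - 2` and `k - 1` are incomparable.
So `0, …, k - 3` form the lower chain, `k - 2` and `k - 1` are the two sides, and
`k, …, 2k - 3` are the `k - 2` neck elements. -/
@[ext]
structure DoubleTailedDiamond (k : ℕ) where
  /-- position of the element -/
  pos : Fin (2 * k - 2)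

instance (k : ℕ) : PartialOrder (DoubleTailedDiamond k) where
  le a b := a = b ∨ (a.pos < b.pos ∧ ¬ (a.pos.val = k - 2 ∧ b.pos.val = k - 1))
  le_refl a := Or.inl rfl
  le_trans a b c := by
    rintro (rfl | ⟨h1, h2⟩) (rfl | ⟨h3, h4⟩)
    · exact Or.inl rfl
    · exact Or.inr ⟨h3, h4⟩
    · exact Or.inr ⟨h1, h2⟩
    · refine Or.inr ⟨h1.trans h3, ?_⟩
      rw [Fin.lt_def] at h1 h3
      omega
  le_antisymm a b := by
    rintro (rfl | ⟨h1, h2⟩) (h | ⟨h3, h4⟩)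
    · rfl
    · rfl
    · exact h.symm
    · exact absurd h3 (not_lt_of_gt h1)

section DComplete

variable {P : Type*} [PartialOrder P]

/-- `[w, z]` is a `d_k`-interval: it is isomorphic to `d_k(1)`. -/
def IsDInterval (k : ℕ) (w z : P) : Prop :=
  Nonempty (Set.Icc w z ≃o DoubleTailedDiamond k)

/-- `A` is a `d_k^-`-convex set: it is convex, and it is isomorphic to `d_k(1)` with its maximal
element (the one in position `2k - 3`) removed. -/
def IsDMinusConvex (k : ℕ) (A : Set P) : Prop :=
  A.OrdConnected ∧ Nonempty (A ≃o {t : DoubleTailedDiamond k // t.pos.val ≠ 2 * k - 3})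

/-- `z` is in the neck of the `d_k`-interval `[w, t]`. -/
def InNeck (k : ℕ) (w t z : P) : Prop :=
  ∃ (e : Set.Icc w t ≃o DoubleTailedDiamond k) (hz : z ∈ Set.Icc w t), k ≤ (e ⟨z, hz⟩).pos.val

variable (P) in
/-- `d`-complete posets. -/
structure IsDComplete : Prop where
  /-- A `d_k^-`-convex set `I` has an element `z` covering the maximal element(s) of `I` such that
  `I ∪ {z}` is a `d_k`-interval. -/
  exists_top : ∀ k, 3 ≤ k → ∀ I : Set P, IsDMinusConvex k I →
    ∃ z, (∀ x, Maximal (· ∈ I) x → x ⋖ z) ∧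
      ∃ w, I ∪ {z} = Set.Icc w z ∧ IsDInterval k w z
  /-- The top of a `d_k`-interval covers nothing outside the interval. -/
  mem_of_covBy : ∀ k, 3 ≤ k → ∀ w z : P, IsDInterval k w z → ∀ y, y ⋖ z → y ∈ Set.Icc w z
  /-- No two `d_k^-`-convex sets differ only in their minimal elements. -/
  eq_of_diff_eq : ∀ k, 3 ≤ k → ∀ (I I' : Set P) (w w' : P), IsDMinusConvex k I →
    IsDMinusConvex k I' → IsLeast I w → IsLeast I' w' → I \ {w} = I' \ {w'} → w = w'

/-- `h` is the hook length function of `P`. If `z` is in the neck of no `d_k`-interval, then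
`h z` is the number of elements `≤ z`. If `z` is in the neck of some `d_k`-interval, then `z` is
the top of a `d_l`-interval `[w, z]`, and `h z = h x + h y - h w`, where `x, y` are the two
incomparable elements of `[w, z]`. -/
structure IsHookLength (h : P → ℕ) : Prop where
  of_not_neck : ∀ z, (∀ k, 3 ≤ k → ∀ w t, ¬ InNeck k w t z) → h z = Nat.card (Set.Iic z)
  of_interval : ∀ l, 3 ≤ l → ∀ w z, IsDInterval l w z → ∀ x ∈ Set.Icc w z, ∀ y ∈ Set.Icc w z,
    ¬ x ≤ y → ¬ y ≤ x → (h z : ℤ) = h x + h y - h w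

variable (P) in
/-- The hook length property: the hook lengths of `P` are well defined, and
`∑_σ q ^ |σ| = ∏_{x ∈ P} 1 / (1 - q ^ h(x))` (as formal power series, denominators cleared). -/
def HookLengthProperty [Fintype P] : Prop :=
  ∃ h : P → ℕ, IsHookLength h ∧ (∀ h' : P → ℕ, IsHookLength h' → h' = h) ∧
    partitionGF P * ∏ x, (1 - (X : ℤ⟦X⟧) ^ h x) = 1

end DComplete

/-! ### The posets `P_n^m(X)` -/

/-- A triple `(λ, len, start)` with `λ` a partition with at most `len` parts and
`start + len - 1 ≤ n`. It prescribes a shifted diagram `(λ + δ_{len + 1})^*` to be glued along its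
diagonal to the chain `x_start < ⋯ < x_{start + len - 1}` inside `x_1 < ⋯ < x_n`. -/
structure Piece (n : ℕ) where
  /-- the partition; `shape r` is its `(r + 1)`-st part -/
  shape : (len : ℕ) × (Fin len → ℕ)
  /-- the index of the lowest diagonal entry used -/
  start : ℕ
  len_pos : 0 < shape.1
  start_pos : 0 < start
  le_n : start + shape.1 - 1 ≤ n
  anti : Antitone shape.2

namespace Piece

variable {n : ℕ} (p : Piece n)

/-- The number of diagonal entries used by the piece. -/
abbrev len : ℕ := p.shape.1

/-- The off-diagonal cells `(r, c)` of the shifted diagram of `λ + δ_{len + 1}`. With rows and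
columns numbered from `0`, row `r` has `λ_{r + 1} + len - r` cells, in the columns
`r, r + 1, …, len + λ_{r + 1} - 1`; the cell `(r, r)` is the diagonal one. -/
abbrev OffDiag : Type := (r : Fin p.len) × Finset.Ioo r.val (p.len + p.shape.2 r)

/-- The index of the diagonal entry `x_i` glued to the diagonal cell `(r, r)`, `r < len`: the cells
`(0, 0), (1, 1), …` are identified with `x_{start + len - 1}, x_{start + len - 2}, …`. -/
def level (r : ℕ) : ℕ := p.start + p.len - (r + 1)

end Piece

/-- The elements of `P_n^m(X)` for a family `X` of `k` pieces: the diagonal entries (`diag a` is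
`x_{a + 1}`), the off-diagonal cells of the pieces, and the `m` elements above `x_n`. -/
inductive GluedPoset {n k : ℕ} (X : Fin k → Piece n) (m : ℕ) : Type
  | diag (a : Fin n) : GluedPoset X m
  | cell (i : Fin k) (u : (X i).OffDiag) : GluedPoset X m
  | above (j : Fin m) : GluedPoset X m

namespace GluedPoset

variable {n k : ℕ} {X : Fin k → Piece n} {m : ℕ}

/-- The order of `P_n^m(X)`. In a shifted diagram `(r, c) ≤ (r', c')` iff `r' ≤ r` and `c' ≤ c`;
hence a cell `(r, c)` is below the diagonal cell `(s, s)` iff `s ≤ r`, and above it iff `c ≤ s`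
(which needs `c < len`). Elements of different pieces are comparable iff they are so through a
diagonal entry. Everything lies below `x_n`, hence below the elements attached above `x_n`. -/
protected def le : GluedPoset X m → GluedPoset X m → Prop
  | diag a, diag b => a ≤ b
  | cell i u, diag b => (X i).level u.1 ≤ b.val + 1
  | diag a, cell j v => v.2.val < (X j).len ∧ a.val + 1 ≤ (X j).level v.2
  | cell i u, cell j v =>
      (i = j ∧ v.1.val ≤ u.1.val ∧ v.2.val ≤ u.2.val) ∨
        (v.2.val < (X j).len ∧ (X i).level u.1 ≤ (X j).level v.2)
  | above i, above j => i ≤ j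
  | above _, diag _ => False
  | above _, cell _ _ => False
  | diag _, above _ => True
  | cell _ _, above _ => True

instance : PartialOrder (GluedPoset X m) where
  le := GluedPoset.le
  le_refl x := by
    rcases x with a | ⟨i, u⟩ | j
    · exact le_refl a
    · exact Or.inl ⟨rfl, le_refl _, le_refl _⟩
    · exact le_refl j
  le_trans x y z := by
    rcases x with a | ⟨i, r, c, hc⟩ | j <;> rcases y with a' | ⟨i', r', c', hc'⟩ | j' <;>
      rcases z with a'' | ⟨i'', r'', c'', hc''⟩ | j'' <;>
      simp only [GluedPoset.le, Piece.level, Fin.le_def] <;> intro h1 h2 <;>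
      try simp only [Finset.mem_Ioo] at *
    all_goals grind
  le_antisymm x y := by
    rcases x with a | ⟨i, u⟩ | j <;> rcases y with a' | ⟨i', v⟩ | j' <;>
      simp only [GluedPoset.le, Piece.level, Fin.le_def] <;> intro h1 h2 <;>
      first | exact False.elim h1 | exact False.elim h2 | skip
    · rw [Fin.ext (le_antisymm h1 h2)]
    · have := (Finset.mem_Ioo.1 v.2.2).1
      have := v.1.2
      omega
    · have := (Finset.mem_Ioo.1 u.2.2).1
      have := u.1.2
      omega
    · have hu := (Finset.mem_Ioo.1 u.2.2).1
      have hv := (Finset.mem_Ioo.1 v.2.2).1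
      have hr := u.1.2
      have hr' := v.1.2
      have key : i = i' ∧ u.1.val = v.1.val ∧ u.2.val = v.2.val := by
        rcases h1 with ⟨rfl, h1⟩ | h1 <;> rcases h2 with ⟨h, h2⟩ | h2
        · omega
        · omega
        · subst h; omega
        · omega
      obtain ⟨r, c, hc⟩ := u
      obtain ⟨r', c', hc'⟩ := v
      obtain ⟨rfl, h, rfl⟩ := key
      obtain rfl := Fin.ext h
      rfl
    · rw [Fin.ext (le_antisymm h1 h2)]

/-- `P_n^m(X)` as a disjoint union of finite types. -/
def equivSum (X : Fin k → Piece n) (m : ℕ) :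
    Fin n ⊕ ((i : Fin k) × (X i).OffDiag) ⊕ Fin m ≃ GluedPoset X m where
  toFun
    | .inl a => diag a
    | .inr (.inl ⟨i, u⟩) => cell i u
    | .inr (.inr j) => above j
  invFun
    | diag a => .inl a
    | cell i u => .inr (.inl ⟨i, u⟩)
    | above j => .inr (.inr j)
  left_inv x := by rcases x with a | ⟨i, u⟩ | j <;> rfl
  right_inv x := by rcases x with a | ⟨i, u⟩ | j <;> rfl

instance : Fintype (GluedPoset X m) := Fintype.ofEquiv _ (equivSum X m)

end GluedPoset

/-! ### Swivels with six diagonal entries -/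

/-- The piece `(∅, len, start)`. -/
def emptyPiece (n len start : ℕ) (h1 : 0 < len) (h2 : 0 < start) (h3 : start + len - 1 ≤ n) :
    Piece n :=
  ⟨⟨len, fun _ => 0⟩, start, h1, h2, h3, fun _ _ _ => le_refl _⟩

/-- `X = {(λ, 5, 1), (∅, 3, 1), (∅, 2, 3), (∅, 3, 4), (∅, 2, 5)}`. -/
def swivelPieces (lam : Fin 5 → ℕ) (hlam : Antitone lam) : Fin 5 → Piece 6 :=
  ![⟨⟨5, lam⟩, 1, by norm_num, by norm_num, by norm_num, hlam⟩,
    emptyPiece 6 3 1 (by norm_num) (by norm_num) (by norm_num),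
    emptyPiece 6 2 3 (by norm_num) (by norm_num) (by norm_num),
    emptyPiece 6 3 4 (by norm_num) (by norm_num) (by norm_num),
    emptyPiece 6 2 5 (by norm_num) (by norm_num) (by norm_num)]

/-- The swivel with six diagonal entries attached to `λ = (lam 0 ≥ ⋯ ≥ lam 4)`: `P_6^{λ_1 + 4}(X)`. -/
abbrev Swivel (lam : Fin 5 → ℕ) (hlam : Antitone lam) : Type :=
  GluedPoset (swivelPieces lam hlam) (lam 0 + 4)

/-! ### Minuscule colourings -/

section Coloring

variable {P C : Type*} [PartialOrder P]

/-! The swivel is the heap of a dominant minuscule element of a simply laced Weyl group, and the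
proof uses only the local properties collected in `MinusculeColoring`. The elements are coloured by
the vertices of a tree with a single branching vertex. Elements of equal or adjacent colours are
comparable, covers join adjacent colours, and between consecutive elements of one colour lie exactly
two elements of adjacent colours. Above the topmost element of a colour there is at most one, and a
similar condition holds below a bottommost element.

d-completeness: the colours of a double-tailed diamond are symmetric about its middle
(`color_neck`), so the d_k-intervals are the intervals between consecutive elements of one colour
(`exists_extend`, `exists_interval`).

Hook lengths: they are the heights `b p` of the roots attached to the elements, given by `b p = 1 +
∑_{q < p} bond q p * b q`. Comparing this sum at the two ends of a link yields the hook recursion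
(`rootHeight_link`), and for a bottommost element of its colour a double count yields the number of
elements below it (`rootHeight_of_bot`).

Product formula: minimal elements are peeled off one at a time. When `p` is removed from an upper
set, the excess of `σ p` over its least allowed value is recorded, and the remaining values of the
colour of `p` are reflected in the intervals allowed by their neighbours, a piecewise linear version
of a simple reflection. Since the weights of the colours change by the dual reflection, the total
weight is preserved once the recorded number is counted `b p` times (`toggleEquiv_weight`). At the
end `|σ| = ∑ b x * m x` with `m` an arbitrary function, and the series is a product of geometric
series.

Finally, the swivel has coordinates (colour, rank) in which `x ≤ y` means that the tree distance of
the colours is at most the difference of the ranks (`isSwivelModel`). The colouring axioms then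
become finite case checks and linear arithmetic. -/

/-- The elements strictly between `x` and `y` whose colour is adjacent to that of `x` are exactly
the two elements `u` and `v`, which have the same colour or are incomparable. -/
structure IsLink (c : P → C) (adj : C → C → Prop) (x y u v : P) : Prop where
  ne : u ≠ v
  mem_iff : ∀ q, (x < q ∧ q < y ∧ adj (c q) (c x)) ↔ q = u ∨ q = v
  color : c u = c v ∨ (¬ u ≤ v ∧ ¬ v ≤ u)

/-- A colouring of a poset by the vertices of a tree with at most one vertex of degree three, which
makes the poset the heap of a dominant minuscule element of the Weyl group. -/
structure MinusculeColoring (c : P → C) (adj : C → C → Prop) : Prop where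
  symm : ∀ {i j}, adj i j → adj j i
  irrefl : ∀ i, ¬ adj i i
  comparable_of_eq : ∀ x y, c x = c y → x ≤ y ∨ y ≤ x
  comparable_of_adj : ∀ x y, adj (c x) (c y) → x ≤ y ∨ y ≤ x
  adj_of_covBy : ∀ x y, x ⋖ y → adj (c x) (c y)
  exists_pred : ∀ x y, x < y → c x = c y → ∃ p u v, p < y ∧ c p = c y ∧
    (∀ q, q < y → c q = c y → q ≤ p) ∧ IsLink c adj p y u v
  eq_of_top : ∀ x, (∀ y, x < y → c y ≠ c x) → ∀ u v, x < u → x < v → adj (c u) (c x) →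
    adj (c v) (c x) → u = v
  eq_of_bot : ∀ p, (∀ q, q < p → c q ≠ c p) → ∀ x, x < p → (∀ q, x < q → q ≤ p → c q ≠ c x) →
    ∀ u v, x < u → u ≤ p → x < v → v ≤ p → adj (c u) (c x) → adj (c v) (c x) → u = v
  no_square : ∀ i j k l, adj i k → adj i l → adj j k → adj j l → i = j ∨ k = l
  degree : ∃ o, (∀ i, i ≠ o → ∀ j k l, adj i j → adj i k → adj i l → j = k ∨ j = l ∨ k = l) ∧
    ∀ j k l m, adj o j → adj o k → adj o l → adj o m →
      j = k ∨ j = l ∨ j = m ∨ k = l ∨ k = m ∨ l = m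

theorem exists_next_of_color_eq [Finite P] (c : P → C) {x y : P} (hxy : x < y) (hc : c y = c x) :
    ∃ z, x < z ∧ z ≤ y ∧ c z = c x ∧ ∀ q, x < q → q < z → c q ≠ c x := by
  obtain ⟨z, hzy, hz⟩ := (Set.toFinite {z | x < z ∧ c z = c x}).exists_le_minimal ⟨hxy, hc⟩
  refine ⟨z, hz.prop.1, hzy, hz.prop.2, fun q h1 h2 h3 => ?_⟩
  exact absurd (hz.le_of_le ⟨h1, h3⟩ h2.le) h2.not_ge

namespace MinusculeColoring

variable {c : P → C} {adj : C → C → Prop} (H : MinusculeColoring c adj)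
include H

theorem ne_of_adj {i j : C} (h : adj i j) : i ≠ j := fun e => H.irrefl j (e ▸ h)

theorem eq_of_four_adj {i j k l m : C} (h1 : adj i j) (h2 : adj i k) (h3 : adj i l)
    (h4 : adj i m) : j = k ∨ j = l ∨ j = m ∨ k = l ∨ k = m ∨ l = m := by
  obtain ⟨o, ho1, ho2⟩ := H.degree
  by_cases hi : i = o
  · exact ho2 _ _ _ _ (hi ▸ h1) (hi ▸ h2) (hi ▸ h3) (hi ▸ h4)
  · have := ho1 i hi _ _ _ h1 h2 h3
    tauto

theorem exists_link {x y : P} (hxy : x < y) (hc : c x = c y)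
    (hn : ∀ q, x < q → q < y → c q ≠ c x) : ∃ u v, IsLink c adj x y u v := by
  obtain ⟨p, u, v, hp, hpc, hmax, hl⟩ := H.exists_pred x y hxy hc
  rcases (hmax x hxy hc).eq_or_lt with rfl | h
  · exact ⟨u, v, hl⟩
  · exact absurd (hpc.trans hc.symm) (hn p h hp)

/-- The colour of `u` is adjacent to that of `w`, hence to that of `z`, so `u` and `z` are
comparable. If `u` were above `z`, then `z` would lie strictly between `w` and `u`. -/
theorem lt_of_covBy_of_eq {w u z : P} (h : w ⋖ u) (hwz : w < z) (hc : c w = c z) : u < z := by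
  have ha := H.adj_of_covBy w u h
  rcases H.comparable_of_adj u z (hc ▸ H.symm ha) with h1 | h1
  · refine h1.lt_of_ne ?_
    rintro rfl
    exact H.ne_of_adj ha hc
  · exact absurd (h1.lt_of_ne (by rintro rfl; exact H.ne_of_adj ha hc)) (h.2 hwz)

theorem lt_of_eq_of_covBy {w u z : P} (h : u ⋖ z) (hwz : w < z) (hc : c w = c z) : w < u := by
  have ha := H.adj_of_covBy u z h
  rcases H.comparable_of_adj u w (hc ▸ ha) with h1 | h1
  · exact absurd hwz (h.2 (h1.lt_of_ne (by rintro rfl; exact H.ne_of_adj ha hc)))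
  · refine h1.lt_of_ne ?_
    rintro rfl
    exact H.ne_of_adj ha hc

/-- Two elements with a single element between them have different colours. -/
theorem ne_of_unique_between {x m y : P} (hxm : x ⋖ m) (hmy : m ⋖ y)
    (h : ∀ s, x < s → s < y → s = m) : c x ≠ c y := by
  intro hc
  obtain ⟨u, v, hl⟩ := H.exists_link (hxm.lt.trans hmy.lt) hc (by
    intro q h1 h2 h3
    rw [h q h1 h2] at h3
    exact H.ne_of_adj (H.adj_of_covBy _ _ hxm) h3.symm)
  have hu := (hl.mem_iff u).2 (Or.inl rfl)
  have hv := (hl.mem_iff v).2 (Or.inr rfl)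
  exact hl.ne ((h u hu.1 hu.2.1).trans (h v hv.1 hv.2.1).symm)

end MinusculeColoring

/-! ### Maps parametrising double-tailed diamonds -/

/-- `g 0, …, g (M - 1)` form a convex copy of the first `M` elements of `d_k(1)`. -/
structure IsDiamondMap (k M : ℕ) (g : ℕ → P) : Prop where
  le_iff : ∀ a < M, ∀ b < M, (g a ≤ g b ↔ a = b ∨ (a < b ∧ ¬ (a = k - 2 ∧ b = k - 1)))
  convex : ∀ a < M, ∀ b < M, ∀ y, g a ≤ y → y ≤ g b → ∃ j < M, g j = y

namespace IsDiamondMap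

variable {k M : ℕ} {g : ℕ → P} (D : IsDiamondMap k M g)
include D

theorem inj {a b : ℕ} (ha : a < M) (hb : b < M) (h : g a = g b) : a = b := by
  have h1 := (D.le_iff a ha b hb).1 h.le
  have h2 := (D.le_iff b hb a ha).1 h.ge
  omega

theorem lt_iff {a b : ℕ} (ha : a < M) (hb : b < M) :
    g a < g b ↔ a < b ∧ ¬ (a = k - 2 ∧ b = k - 1) := by
  rw [lt_iff_le_not_ge, D.le_iff a ha b hb, D.le_iff b hb a ha]
  omega

theorem covBy {a b : ℕ} (ha : a < M) (hb : b < M) (h1 : a < b) (h2 : ¬ (a = k - 2 ∧ b = k - 1))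
    (h3 : ∀ j, a < j → j < b → (a = k - 2 ∧ j = k - 1) ∨ (j = k - 2 ∧ b = k - 1)) :
    g a ⋖ g b := by
  refine ⟨(D.lt_iff ha hb).2 ⟨h1, h2⟩, fun y hy1 hy2 => ?_⟩
  obtain ⟨j, hj, rfl⟩ := D.convex a ha b hb y hy1.le hy2.le
  have h4 := (D.lt_iff ha hj).1 hy1
  have h5 := (D.lt_iff hj hb).1 hy2
  have := h3 j h4.1 h5.1
  omega

end IsDiamondMap

/-- With positions as natural numbers, comparisons inside a diamond become arithmetic of indices. -/
theorem IsDMinusConvex.exists_map {k : ℕ} (hk : 3 ≤ k) {I : Set P} (h : IsDMinusConvex k I) :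
    ∃ g : ℕ → P, IsDiamondMap k (2 * k - 3) g ∧ ∀ y, y ∈ I ↔ ∃ j < 2 * k - 3, g j = y := by
  obtain ⟨hc, ⟨e⟩⟩ := h
  have hI : ∀ j, j < 2 * k - 3 → j < 2 * k - 2 := by omega
  let f : ∀ j, j < 2 * k - 3 → {t : DoubleTailedDiamond k // t.pos.val ≠ 2 * k - 3} :=
    fun j hj => ⟨⟨⟨j, hI j hj⟩⟩, by simp; omega⟩
  -- Beyond the range `g` takes an irrelevant default value.
  let g : ℕ → P := fun j => if hj : j < 2 * k - 3 then (e.symm (f j hj) : P) else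
    (e.symm (f 0 (by omega)) : P)
  have hg : ∀ j (hj : j < 2 * k - 3), g j = e.symm (f j hj) := fun j hj => by simp [g, hj]
  have hmem : ∀ y, y ∈ I ↔ ∃ j < 2 * k - 3, g j = y := by
    intro y
    constructor
    · intro hy
      have h1 := (e ⟨y, hy⟩).1.pos.2
      have h2 := (e ⟨y, hy⟩).2
      have h3 : (e ⟨y, hy⟩).1.pos.val < 2 * k - 3 := by omega
      refine ⟨_, h3, ?_⟩
      rw [hg _ h3]
      have : f _ h3 = e ⟨y, hy⟩ := rfl
      rw [this, OrderIso.symm_apply_apply]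
    · rintro ⟨j, hj, rfl⟩
      rw [hg j hj]
      exact (e.symm (f j hj)).2
  refine ⟨g, ⟨fun a ha b hb => ?_, fun a ha b hb y h1 h2 => ?_⟩, hmem⟩
  · rw [hg a ha, hg b hb, Subtype.coe_le_coe, OrderIso.le_iff_le]
    change ((f a ha).1 = (f b hb).1 ∨ _) ↔ _
    simp [f]
  · exact (hmem y).1 (hc.out ((hmem _).2 ⟨a, ha, rfl⟩) ((hmem _).2 ⟨b, hb, rfl⟩) ⟨h1, h2⟩)

/-- The last clause ties `g` to the given isomorphism, because `InNeck` speaks of positions under a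
particular one. -/
theorem exists_map_of_orderIso {k : ℕ} (hk : 3 ≤ k) {w z : P}
    (e : Set.Icc w z ≃o DoubleTailedDiamond k) :
    ∃ g : ℕ → P, IsDiamondMap k (2 * k - 2) g ∧ g 0 = w ∧ g (2 * k - 3) = z ∧
      ∀ y (hy : y ∈ Set.Icc w z), g (e ⟨y, hy⟩).pos.val = y := by
  let f : ∀ j, j < 2 * k - 2 → DoubleTailedDiamond k := fun j hj => ⟨⟨j, hj⟩⟩
  let g : ℕ → P := fun j => if hj : j < 2 * k - 2 then (e.symm (f j hj) : P) else
    (e.symm (f 0 (by omega)) : P)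
  have hg : ∀ j (hj : j < 2 * k - 2), g j = e.symm (f j hj) := fun j hj => by simp [g, hj]
  have hval : ∀ y (hy : y ∈ Set.Icc w z), g (e ⟨y, hy⟩).pos.val = y := by
    intro y hy
    rw [hg _ (e ⟨y, hy⟩).pos.2]
    have : f _ (e ⟨y, hy⟩).pos.2 = e ⟨y, hy⟩ := rfl
    rw [this, OrderIso.symm_apply_apply]
  have hle : ∀ a < 2 * k - 2, ∀ b < 2 * k - 2,
      (g a ≤ g b ↔ a = b ∨ (a < b ∧ ¬ (a = k - 2 ∧ b = k - 1))) := by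
    intro a ha b hb
    rw [hg a ha, hg b hb, Subtype.coe_le_coe, OrderIso.le_iff_le]
    change (f a ha = f b hb ∨ _) ↔ _
    simp [f]
  have hmem : ∀ j < 2 * k - 2, g j ∈ Set.Icc w z := by
    intro j hj
    rw [hg j hj]
    exact (e.symm (f j hj)).2
  have hwz : w ≤ z := (hmem 0 (by omega)).1.trans (hmem 0 (by omega)).2
  refine ⟨g, ⟨hle, fun a ha b hb y h1 h2 => ?_⟩, ?_, ?_, hval⟩
  · have hy : y ∈ Set.Icc w z := ⟨(hmem a ha).1.trans h1, h2.trans (hmem b hb).2⟩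
    exact ⟨_, (e ⟨y, hy⟩).pos.2, hval y hy⟩
  · apply le_antisymm _ (hmem 0 (by omega)).1
    have := hval w (Set.left_mem_Icc.2 hwz)
    rw [← this, hle _ (by omega) _ (Fin.is_lt _)]
    omega
  · apply le_antisymm (hmem _ (by omega)).2
    have := hval z (Set.right_mem_Icc.2 hwz)
    have h3 := (e ⟨z, Set.right_mem_Icc.2 hwz⟩).pos.2
    rw [← this, hle _ (Fin.is_lt _) _ (by omega)]
    omega

theorem IsDiamondMap.isDInterval {k : ℕ} (hk : 3 ≤ k) {g : ℕ → P}
    (D : IsDiamondMap k (2 * k - 2) g) : IsDInterval k (g 0) (g (2 * k - 3)) := by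
  have hmem : ∀ j < 2 * k - 2, g j ∈ Set.Icc (g 0) (g (2 * k - 3)) := by
    intro j hj
    rw [Set.mem_Icc, D.le_iff _ (by omega) _ hj, D.le_iff _ hj _ (by omega)]
    omega
  let F : DoubleTailedDiamond k → Set.Icc (g 0) (g (2 * k - 3)) :=
    fun t => ⟨g t.pos, hmem _ t.pos.2⟩
  have hF : ∀ {a b}, F a ≤ F b ↔ a ≤ b := by
    intro a b
    change g a.pos ≤ g b.pos ↔ (a = b ∨ _)
    rw [D.le_iff _ a.pos.2 _ b.pos.2, DoubleTailedDiamond.ext_iff, Fin.ext_iff, Fin.lt_def]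
  have hs : Function.Surjective F := by
    rintro ⟨y, hy⟩
    obtain ⟨j, hj, rfl⟩ := D.convex 0 (by omega) (2 * k - 3) (by omega) y hy.1 hy.2
    exact ⟨⟨⟨j, hj⟩⟩, rfl⟩
  have hi : Function.Injective F := fun a b h => le_antisymm (hF.1 h.le) (hF.1 h.ge)
  exact ⟨(⟨Equiv.ofBijective F ⟨hi, hs⟩, hF⟩ : DoubleTailedDiamond k ≃o _).symm⟩

end Coloring

/-! ### Colours along a double-tailed diamond. -/

section Coloring

variable {P C : Type*} [PartialOrder P]

namespace IsDiamondMap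

variable {c : P → C} {adj : C → C → Prop} {k M : ℕ} {g : ℕ → P}

/-- In the lower half, a closest pair of comparable elements of one colour would have a link
strictly between them. The two link elements cannot be incomparable, since both sides do not fit
below a position `≤ k - 1`; so they share a colour and form a pair with a smaller gap. -/
theorem color_ne [Finite P] (D : IsDiamondMap k M g) (H : MinusculeColoring c adj) (hM : 2 * k - 3 ≤ M)
    (hk : 3 ≤ k) : ∀ n a b, b - a = n → a < b → b ≤ k - 1 → ¬ (a = k - 2 ∧ b = k - 1) →
      c (g a) ≠ c (g b) := by
  intro n
  induction n using Nat.strong_induction_on with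
  | _ n ih =>
    intro a b hn hab hb hs hc
    have hlt : g a < g b := (D.lt_iff (by omega) (by omega)).2 ⟨hab, hs⟩
    obtain ⟨z, h1, h2, h3, h4⟩ := exists_next_of_color_eq c hlt hc.symm
    obtain ⟨j, hj, rfl⟩ := D.convex a (by omega) b (by omega) z h1.le h2
    have h5 := (D.lt_iff (by omega) hj).1 h1
    have h6 := (D.le_iff j hj b (by omega)).1 h2
    rcases h6 with rfl | h6
    · obtain ⟨u, v, hl⟩ := H.exists_link hlt hc h4
      have hu := (hl.mem_iff u).2 (Or.inl rfl)
      have hv := (hl.mem_iff v).2 (Or.inr rfl)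
      obtain ⟨p, hp, rfl⟩ := D.convex a (by omega) j hj u hu.1.le hu.2.1.le
      obtain ⟨q, hq, rfl⟩ := D.convex a (by omega) j hj v hv.1.le hv.2.1.le
      have e1 := (D.lt_iff (by omega) hp).1 hu.1
      have e2 := (D.lt_iff (by omega) hq).1 hv.1
      have e3 := (D.lt_iff hp hj).1 hu.2.1
      have e4 := (D.lt_iff hq hj).1 hv.2.1
      have hpq : p ≠ q := fun h => hl.ne (h ▸ rfl)
      rcases hl.color with h | ⟨h, h'⟩
      · rcases lt_or_gt_of_ne hpq with h7 | h7
        · exact ih (q - p) (by omega) p q rfl h7 (by omega) (by omega) h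
        · exact ih (p - q) (by omega) q p rfl h7 (by omega) (by omega) h.symm
      · rw [D.le_iff p hp q hq] at h
        rw [D.le_iff q hq p hp] at h'
        omega
    · exact ih (j - a) (by omega) a j rfl h5.1 (by omega) h5.2 h3.symm

theorem color_side_ne (D : IsDiamondMap k M g) (H : MinusculeColoring c adj) (hM : 2 * k - 3 ≤ M)
    (hk : 3 ≤ k) : c (g (k - 2)) ≠ c (g (k - 1)) := by
  intro h
  have := H.comparable_of_eq _ _ h
  rw [D.le_iff _ (by omega) _ (by omega), D.le_iff _ (by omega) _ (by omega)] at this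
  omega

theorem adj_of_covBy (D : IsDiamondMap k M g) (H : MinusculeColoring c adj) {a b : ℕ} (ha : a < M)
    (hb : b < M) (h1 : a < b) (h2 : ¬ (a = k - 2 ∧ b = k - 1))
    (h3 : ∀ j, a < j → j < b → (a = k - 2 ∧ j = k - 1) ∨ (j = k - 2 ∧ b = k - 1)) :
    adj (c (g a)) (c (g b)) :=
  H.adj_of_covBy _ _ (D.covBy ha hb h1 h2 h3)

theorem color_ne_of_unique (D : IsDiamondMap k M g) (H : MinusculeColoring c adj) {a m b : ℕ}
    (ha : a < M) (hb : b < M) (hm : a < m ∧ m < b) (h1 : ¬ (a = k - 2 ∧ m = k - 1))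
    (h2 : ¬ (m = k - 2 ∧ b = k - 1))
    (h3 : ∀ j, a < j → j < b → j ≠ m →
      (a = k - 2 ∧ j = k - 1) ∨ (j = k - 2 ∧ b = k - 1)) : c (g a) ≠ c (g b) := by
  have hs : ∀ s, g a < s → s < g b → s = g m := by
    intro s hs1 hs2
    obtain ⟨j, hj, rfl⟩ := D.convex a ha b hb s hs1.le hs2.le
    have h4 := (D.lt_iff ha hj).1 hs1
    have h5 := (D.lt_iff hj hb).1 hs2
    by_contra h6
    have := h3 j h4.1 h5.1 (fun h => h6 (h ▸ rfl))
    omega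
  have l1 : g a < g m := (D.lt_iff ha (by omega)).2 ⟨hm.1, h1⟩
  have l2 : g m < g b := (D.lt_iff (by omega) hb).2 ⟨hm.2, h2⟩
  refine H.ne_of_unique_between ⟨l1, fun s e1 e2 => ?_⟩ ⟨l2, fun s e1 e2 => ?_⟩ hs
  · exact e2.ne (hs s e1 (e2.trans l2))
  · exact e1.ne' (hs s (l1.trans e1) e2)

/-- Position `k - 3` has three distinct neighbouring colours, namely those of the two sides and of
position `k - 4`. Hence its colour is the branching vertex of the tree, and the different colour of
a lower position has degree at most two. -/
theorem eq_of_three_adj [Finite P] (D : IsDiamondMap k M g) (H : MinusculeColoring c adj)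
    (hM : 2 * k - 3 ≤ M) {a : ℕ} (ha : a + 3 < k) {i j l : C} (h1 : adj (c (g a)) i)
    (h2 : adj (c (g a)) j) (h3 : adj (c (g a)) l) : i = j ∨ i = l ∨ j = l := by
  have a1 : adj (c (g (k - 3))) (c (g (k - 2))) :=
    D.adj_of_covBy H (by omega) (by omega) (by omega) (by omega) (by omega)
  have a2 : adj (c (g (k - 3))) (c (g (k - 1))) :=
    D.adj_of_covBy H (by omega) (by omega) (by omega) (by omega) (by omega)
  have a3 : adj (c (g (k - 4))) (c (g (k - 3))) :=
    D.adj_of_covBy H (by omega) (by omega) (by omega) (by omega) (by omega)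
  have n1 : c (g (k - 4)) ≠ c (g (k - 2)) :=
    D.color_ne H hM (by omega) _ _ _ rfl (by omega) (by omega) (by omega)
  have n2 : c (g (k - 4)) ≠ c (g (k - 1)) :=
    D.color_ne H hM (by omega) _ _ _ rfl (by omega) (by omega) (by omega)
  have n3 : c (g a) ≠ c (g (k - 3)) :=
    D.color_ne H hM (by omega) _ _ _ rfl (by omega) (by omega) (by omega)
  have n4 := D.color_side_ne H hM (by omega)
  obtain ⟨o, ho1, ho2⟩ := H.degree
  by_cases hi : c (g a) = o
  · have := ho1 (c (g (k - 3))) (fun h => n3 (hi.trans h.symm)) _ _ _ a1 a2 (H.symm a3)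
    tauto
  · exact ho1 _ hi _ _ _ h1 h2 h3

/-- Elements of a double-tailed diamond in opposite positions have the same colour. -/
theorem color_neck [Finite P] (D : IsDiamondMap k M g) (H : MinusculeColoring c adj) (hM : 2 * k - 3 ≤ M)
    (hM' : M ≤ 2 * k - 2) (hk : 3 ≤ k) :
    ∀ j, 1 ≤ j → k - 1 + j < M → c (g (k - 1 + j)) = c (g (k - 2 - j)) := by
  intro j
  induction j using Nat.strong_induction_on with
  | _ j ih =>
    intro h1 hj
    have hside := D.color_side_ne H hM hk
    obtain rfl | rfl | h3 : j = 1 ∨ j = 2 ∨ 3 ≤ j := by omega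
    -- The elements just above and just below the sides have both side colours as neighbours; the
    -- tree has no 4-cycle.
    · have a1 : adj (c (g (k - 2))) (c (g (k - 1 + 1))) :=
        D.adj_of_covBy H (by omega) (by omega) (by omega) (by omega) (by omega)
      have a2 : adj (c (g (k - 1))) (c (g (k - 1 + 1))) :=
        D.adj_of_covBy H (by omega) (by omega) (by omega) (by omega) (by omega)
      have a3 : adj (c (g (k - 2 - 1))) (c (g (k - 2))) :=
        D.adj_of_covBy H (by omega) (by omega) (by omega) (by omega) (by omega)
      have a4 : adj (c (g (k - 2 - 1))) (c (g (k - 1))) :=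
        D.adj_of_covBy H (by omega) (by omega) (by omega) (by omega) (by omega)
      exact (H.no_square _ _ _ _ (H.symm a1) (H.symm a2) a3 a4).resolve_right hside
    -- The colour of position `k - 3` is adjacent to four colours: those of the sides and of
    -- positions `k - 4` and `k + 1`. Only the last two can coincide.
    · have e := ih 1 (by omega) (by omega) (by omega)
      have a1 : adj (c (g (k - 2 - 1))) (c (g (k - 2))) :=
        D.adj_of_covBy H (by omega) (by omega) (by omega) (by omega) (by omega)
      have a2 : adj (c (g (k - 2 - 1))) (c (g (k - 1))) :=
        D.adj_of_covBy H (by omega) (by omega) (by omega) (by omega) (by omega)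
      have a3 : adj (c (g (k - 2 - 2))) (c (g (k - 2 - 1))) :=
        D.adj_of_covBy H (by omega) (by omega) (by omega) (by omega) (by omega)
      have a4 : adj (c (g (k - 1 + 1))) (c (g (k - 1 + 2))) :=
        D.adj_of_covBy H (by omega) (by omega) (by omega) (by omega) (by omega)
      rw [e] at a4
      have n1 : c (g (k - 2 - 2)) ≠ c (g (k - 2)) :=
        D.color_ne H hM hk _ _ _ rfl (by omega) (by omega) (by omega)
      have n2 : c (g (k - 2 - 2)) ≠ c (g (k - 1)) :=
        D.color_ne H hM hk _ _ _ rfl (by omega) (by omega) (by omega)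
      have n3 : c (g (k - 2)) ≠ c (g (k - 1 + 2)) :=
        D.color_ne_of_unique H (m := k - 1 + 1) (by omega) (by omega) (by omega) (by omega)
          (by omega) (by omega)
      have n4 : c (g (k - 1)) ≠ c (g (k - 1 + 2)) :=
        D.color_ne_of_unique H (m := k - 1 + 1) (by omega) (by omega) (by omega) (by omega)
          (by omega) (by omega)
      have := H.eq_of_four_adj a1 a2 (H.symm a3) a4
      tauto
    -- Farther out the tail colours have degree at most two, so the next colour is forced.
    · have e1 := ih (j - 1) (by omega) (by omega) (by omega)
      have e2 := ih (j - 2) (by omega) (by omega) (by omega)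
      have a1 : adj (c (g (k - 2 - (j - 1)))) (c (g (k - 2 - (j - 2)))) :=
        D.adj_of_covBy H (by omega) (by omega) (by omega) (by omega) (by omega)
      have a2 : adj (c (g (k - 2 - j))) (c (g (k - 2 - (j - 1)))) :=
        D.adj_of_covBy H (by omega) (by omega) (by omega) (by omega) (by omega)
      have a3 : adj (c (g (k - 1 + (j - 1)))) (c (g (k - 1 + j))) :=
        D.adj_of_covBy H (by omega) (by omega) (by omega) (by omega) (by omega)
      rw [e1] at a3
      have n1 : c (g (k - 2 - j)) ≠ c (g (k - 2 - (j - 2))) :=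
        D.color_ne H hM hk _ _ _ rfl (by omega) (by omega) (by omega)
      have n2 : c (g (k - 1 + (j - 2))) ≠ c (g (k - 1 + j)) :=
        D.color_ne_of_unique H (m := k - 1 + (j - 1)) (by omega) (by omega) (by omega) (by omega)
          (by omega) (by omega)
      rw [e2] at n2
      have := D.eq_of_three_adj H hM (by omega) a1 (H.symm a2) a3
      tauto

/-- Between two neck-opposite elements of the diamond there is no element of their colour. -/
theorem color_ne_between [Finite P] (D : IsDiamondMap k M g) (H : MinusculeColoring c adj)
    (hM : 2 * k - 3 ≤ M) (hM' : M ≤ 2 * k - 2) (hk : 3 ≤ k) {a b : ℕ} (ha : a + 3 ≤ k)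
    (hab : a < b) (hb : b < 2 * k - 3 - a) : c (g b) ≠ c (g a) := by
  rcases Nat.lt_or_ge b k with h | h
  · exact (D.color_ne H hM hk _ _ _ rfl hab (by omega) (by omega)).symm
  · have e := D.color_neck H hM hM' hk (b - (k - 1)) (by omega) (by omega)
    rw [show k - 1 + (b - (k - 1)) = b by omega] at e
    rw [e]
    exact (D.color_ne H hM hk _ _ _ rfl (by omega) (by omega) (by omega)).symm

/-- A `d_k^-`-convex set is completed to a `d_k`-interval by the next element of the colour of its
minimal element. -/
theorem exists_extend [Finite P] (D : IsDiamondMap k (2 * k - 3) g) (H : MinusculeColoring c adj)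
    (hk : 3 ≤ k) : ∃ z, g 0 < z ∧ (∀ y, g 0 ≤ y → y < z → ∃ j < 2 * k - 3, g j = y) ∧
      ∀ j < 2 * k - 3, g j < z := by
  -- These are the future link elements: the two sides if `k = 3`, otherwise positions `1` and `2k -
  -- 4`, which have equal colours by the symmetry of the diamond.
  obtain ⟨u, v, hu, hv, huv, au, av, cu⟩ : ∃ u v, u < 2 * k - 3 ∧ v < 2 * k - 3 ∧ u ≠ v ∧
      adj (c (g u)) (c (g 0)) ∧ adj (c (g v)) (c (g 0)) ∧
      (g 0 ⋖ g u) ∧ 0 < v ∧ (g 0 ⋖ g v ∨ v = 2 * k - 4) ∧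
      ∀ j < 2 * k - 3, g j ≤ g u ∨ g j ≤ g v := by
    rcases hk.eq_or_lt with rfl | hk'
    · have c1 : g 0 ⋖ g 1 := D.covBy (by omega) (by omega) (by omega) (by omega) (by omega)
      have c2 : g 0 ⋖ g 2 := D.covBy (by omega) (by omega) (by omega) (by omega) (by omega)
      refine ⟨1, 2, by omega, by omega, by omega, H.symm (H.adj_of_covBy _ _ c1),
        H.symm (H.adj_of_covBy _ _ c2), c1, by omega, Or.inl c2, fun j hj => ?_⟩
      rw [D.le_iff _ (by omega) _ (by omega), D.le_iff _ (by omega) _ (by omega)]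
      omega
    · have c1 : g 0 ⋖ g 1 := D.covBy (by omega) (by omega) (by omega) (by omega) (by omega)
      refine ⟨1, 2 * k - 4, by omega, by omega, by omega, H.symm (H.adj_of_covBy _ _ c1), ?_, c1,
        by omega, Or.inr rfl, fun j hj => Or.inr ?_⟩
      · have e := D.color_neck H le_rfl (by omega) hk (k - 3) (by omega) (by omega)
        rw [show k - 1 + (k - 3) = 2 * k - 4 by omega, show k - 2 - (k - 3) = 1 by omega] at e
        rw [e]
        exact H.symm (H.adj_of_covBy _ _ c1)
      · rw [D.le_iff _ (by omega) _ (by omega)]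
        omega
  obtain ⟨cu, hv0, cv, htop⟩ := cu
  have h0v : g 0 < g v := (D.lt_iff (by omega) hv).2 ⟨hv0, by omega⟩
  -- Otherwise `g 0` is topmost of its colour, with two different elements of adjacent colours above
  -- it.
  obtain ⟨y, hy, hyc⟩ : ∃ y, g 0 < y ∧ c y = c (g 0) := by
    by_contra hcon
    push Not at hcon
    exact huv (D.inj hu hv (H.eq_of_top (g 0) hcon _ _ cu.lt h0v au av))
  obtain ⟨z, h0z, -, hzc, hz⟩ := exists_next_of_color_eq c hy hyc
  have huz : g u < z := H.lt_of_covBy_of_eq cu h0z hzc.symm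
  have hvz : g v < z := by
    rcases cv with cv | rfl
    · exact H.lt_of_covBy_of_eq cv h0z hzc.symm
    · rcases H.comparable_of_adj _ z (hzc.symm ▸ av) with h | h
      · exact h.lt_of_ne fun h => H.ne_of_adj av (h ▸ hzc)
      · obtain ⟨j, hj, rfl⟩ := D.convex 0 (by omega) _ hv z h0z.le h
        have h1 := (D.lt_iff (by omega) hj).1 h0z
        exact absurd hzc (D.color_ne_between H le_rfl (by omega) hk (by omega) h1.1 (by omega))
  obtain ⟨u', v', hl⟩ := H.exists_link h0z hzc.symm hz
  -- The link between `g 0` and `z` has only two places, and `g u` and `g v` fill them.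
  have hmem : ∀ q, g 0 < q → q < z → adj (c q) (c (g 0)) → q = g u ∨ q = g v := by
    intro q h1 h2 h3
    have e1 := (hl.mem_iff q).1 ⟨h1, h2, h3⟩
    have e2 := (hl.mem_iff _).1 ⟨cu.lt, huz, au⟩
    have e3 := (hl.mem_iff _).1 ⟨h0v, hvz, av⟩
    have e4 : g u ≠ g v := fun h => huv (D.inj hu hv h)
    rcases e1 with rfl | rfl <;> rcases e2 with e2 | e2 <;> rcases e3 with e3 | e3 <;>
      simp_all
  refine ⟨z, h0z, fun y h1 h2 => ?_, fun j hj => ?_⟩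
  · rcases h1.eq_or_lt with rfl | h1
    · exact ⟨0, by omega, rfl⟩
    -- A maximal chain through `y` leaves `g 0` and enters `z` through elements of adjacent colours,
    -- hence through `g u` or `g v`, and the old set is convex.
    · obtain ⟨p, hp, hpy⟩ := exists_covBy_le_of_lt h1
      obtain ⟨q, hyq, hq⟩ := exists_le_covBy_of_lt h2
      have hpm := hmem p hp.lt (hpy.trans_lt h2) (H.symm (H.adj_of_covBy _ _ hp))
      have hqm := hmem q (h1.trans_le hyq) hq.lt (hzc ▸ H.adj_of_covBy _ _ hq)
      obtain ⟨p', hp', rfl⟩ : ∃ p' < 2 * k - 3, g p' = p := by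
        rcases hpm with rfl | rfl
        exacts [⟨u, hu, rfl⟩, ⟨v, hv, rfl⟩]
      obtain ⟨q', hq', rfl⟩ : ∃ q' < 2 * k - 3, g q' = q := by
        rcases hqm with rfl | rfl
        exacts [⟨u, hu, rfl⟩, ⟨v, hv, rfl⟩]
      exact D.convex _ hp' _ hq' y hpy hyq
  · rcases htop j hj with h | h
    exacts [h.trans_lt huz, h.trans_lt hvz]

end IsDiamondMap

end Coloring

/-! ### The three axioms of d-completeness. -/

section Coloring

variable {P C : Type*} [PartialOrder P] {c : P → C} {adj : C → C → Prop}

/-- Adding a top element to a `d_k^-`-convex set. -/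
theorem IsDiamondMap.snoc {k : ℕ} {g : ℕ → P} {z : P} (hk : 3 ≤ k)
    (D : IsDiamondMap k (2 * k - 3) g)
    (h1 : ∀ y, g 0 ≤ y → y < z → ∃ j < 2 * k - 3, g j = y) (h2 : ∀ j < 2 * k - 3, g j < z) :
    IsDiamondMap k (2 * k - 2) (fun j => if j < 2 * k - 3 then g j else z) := by
  have h0 : ∀ j < 2 * k - 3, g 0 ≤ g j := by
    intro j hj
    rw [D.le_iff _ (by omega) _ hj]
    omega
  constructor
  · intro a ha b hb
    by_cases ha' : a < 2 * k - 3 <;> by_cases hb' : b < 2 * k - 3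
    · simp only [ha', hb', if_true]
      exact D.le_iff a ha' b hb'
    · simp only [ha', hb', if_true, if_false, (h2 a ha').le, true_iff]
      omega
    · simp only [ha', hb', if_true, if_false, (h2 b hb').not_ge, false_iff]
      omega
    · simp only [ha', hb', if_false, le_refl, true_iff]
      omega
  · intro a ha b hb y hy1 hy2
    have hy0 : g 0 ≤ y := by
      refine le_trans ?_ hy1
      split_ifs with h
      exacts [h0 a h, (h2 0 (by omega)).le]
    have hyz : y ≤ z := by
      refine hy2.trans ?_
      split_ifs with h
      exacts [(h2 b h).le, le_rfl]
    rcases hyz.eq_or_lt with rfl | hyz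
    · exact ⟨2 * k - 3, by omega, by simp⟩
    · obtain ⟨j, hj, rfl⟩ := h1 y hy0 hyz
      exact ⟨j, by omega, by simp [hj]⟩

variable [Finite P]

namespace MinusculeColoring

variable (H : MinusculeColoring c adj)
include H

theorem dComplete_exists_top {k : ℕ} (hk : 3 ≤ k) {I : Set P} (hI : IsDMinusConvex k I) :
    ∃ z, (∀ x, Maximal (· ∈ I) x → x ⋖ z) ∧ ∃ w, I ∪ {z} = Set.Icc w z ∧ IsDInterval k w z := by
  obtain ⟨g, D, hg⟩ := hI.exists_map hk
  obtain ⟨z, h0z, h1, h2⟩ := D.exists_extend H hk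
  have hlt : ∀ x ∈ I, x < z := by
    intro x hx
    obtain ⟨j, hj, rfl⟩ := (hg x).1 hx
    exact h2 j hj
  have hge : ∀ x ∈ I, g 0 ≤ x := by
    intro x hx
    obtain ⟨j, hj, rfl⟩ := (hg x).1 hx
    rw [D.le_iff _ (by omega) _ hj]
    omega
  refine ⟨z, fun x hx => ⟨hlt x hx.prop, fun y hxy hyz => ?_⟩, g 0, ?_, ?_⟩
  · have hy : y ∈ I := (hg y).2 (h1 y ((hge x hx.prop).trans hxy.le) hyz)
    exact absurd (hx.le_of_ge hy hxy.le) hxy.not_ge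
  · ext y
    simp only [Set.union_singleton, Set.mem_insert_iff, Set.mem_Icc]
    constructor
    · rintro (rfl | hy)
      exacts [⟨h0z.le, le_rfl⟩, ⟨hge y hy, (hlt y hy).le⟩]
    · rintro ⟨hy1, hy2⟩
      rcases hy2.eq_or_lt with h | h
      exacts [Or.inl h, Or.inr ((hg y).2 (h1 y hy1 h))]
  · have := (D.snoc hk h1 h2).isDInterval hk
    simpa [show 0 < 2 * k - 3 by omega] using this

theorem color_eq_of_map {k : ℕ} (hk : 3 ≤ k) {g : ℕ → P} (D : IsDiamondMap k (2 * k - 2) g) :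
    c (g (2 * k - 3)) = c (g 0) := by
  have := D.color_neck H (by omega) le_rfl hk (k - 2) (by omega) (by omega)
  rwa [show k - 1 + (k - 2) = 2 * k - 3 by omega, show k - 2 - (k - 2) = 0 by omega] at this

/-- The bottom `w` has the colour of `z`, so an element covered by `z` has a colour adjacent to that
of `w`, is comparable with `w`, and must be above it. -/
theorem dComplete_mem_of_covBy {k : ℕ} (hk : 3 ≤ k) {w z : P} (h : IsDInterval k w z) {y : P}
    (hy : y ⋖ z) : y ∈ Set.Icc w z := by
  obtain ⟨e⟩ := h
  obtain ⟨g, D, rfl, rfl, -⟩ := exists_map_of_orderIso hk e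
  refine ⟨(H.lt_of_eq_of_covBy hy ?_ (H.color_eq_of_map hk D).symm).le, hy.le⟩
  rw [D.lt_iff (by omega) (by omega)]
  omega

/-- It suffices that the minimal elements have equal colours: then they are comparable, and `g 1`
covers both. For `k = 3` this is the absence of 4-cycles; for larger `k` the colour of `g 1` would
otherwise have too many neighbours, as the degree is at most three for `k = 4` and two for `k > 4`.
-/
theorem dComplete_eq_of_diff_eq {k : ℕ} (hk : 3 ≤ k) {I I' : Set P} {w w' : P}
    (hI : IsDMinusConvex k I) (hI' : IsDMinusConvex k I') (hw : IsLeast I w) (hw' : IsLeast I' w')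
    (h : I \ {w} = I' \ {w'}) : w = w' := by
  obtain ⟨g, D, hg⟩ := hI.exists_map hk
  obtain rfl : w = g 0 := by
    apply le_antisymm (hw.2 ((hg _).2 ⟨0, by omega, rfl⟩))
    obtain ⟨j, hj, rfl⟩ := (hg w).1 hw.1
    rw [D.le_iff _ (by omega) _ hj]
    omega
  have hI1 : ∀ s, s ∈ I' → s ≠ w' → s ∈ I ∧ s ≠ g 0 := fun s h1 h2 => by
    have : s ∈ I' \ {w'} := ⟨h1, h2⟩
    rw [← h] at this
    exact this
  have hI2 : ∀ s, s ∈ I → s ≠ g 0 → s ∈ I' ∧ s ≠ w' := fun s h1 h2 => by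
    have : s ∈ I \ {g 0} := ⟨h1, h2⟩
    rw [h] at this
    exact this
  have hlt : ∀ s, s ∈ I → s ≠ g 0 → w' < s := fun s h1 h2 =>
    lt_of_le_of_ne (hw'.2 (hI2 s h1 h2).1) (hI2 s h1 h2).2.symm
  have hbet : ∀ s, s ∈ I → s ≠ g 0 → ∀ t, w' < t → t < s → g 0 < t := fun s h1 h2 t ht hts => by
    have ht' : t ∈ I' := hI'.1.out hw'.1 (hI2 s h1 h2).1 ⟨ht.le, hts.le⟩
    have := hI1 t ht' ht.ne'
    exact lt_of_le_of_ne (hw.2 this.1) this.2.symm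
  have hcov : ∀ s, s ∈ I → g 0 ⋖ s → w' ⋖ s := fun s h1 h2 =>
    ⟨hlt s h1 h2.lt.ne', fun t ht hts => h2.2 (hbet s h1 h2.lt.ne' t ht hts) hts⟩
  have hmem : ∀ j < 2 * k - 3, g j ∈ I := fun j hj => (hg _).2 ⟨j, hj, rfl⟩
  have c1 : g 0 ⋖ g 1 := D.covBy (by omega) (by omega) (by omega) (by omega) (by omega)
  have c1' := hcov _ (hmem 1 (by omega)) c1
  have a1 := H.adj_of_covBy _ _ c1
  have a1' := H.adj_of_covBy _ _ c1'
  have hcol : c (g 0) = c w' := by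
    rcases hk.eq_or_lt with rfl | hk'
    · have c2 : g 0 ⋖ g 2 := D.covBy (by omega) (by omega) (by omega) (by omega) (by omega)
      have c2' := hcov _ (hmem 2 (by omega)) c2
      have a2 := H.adj_of_covBy _ _ c2
      have a2' := H.adj_of_covBy _ _ c2'
      exact (H.no_square _ _ _ _ a1 a2 a1' a2').resolve_right (D.color_side_ne H le_rfl le_rfl)
    -- If `g 1` is the only element strictly between two others, there is no room for a link, so
    -- their colours differ.
    · have key : ∀ b, b < 2 * k - 3 → g 1 ⋖ g b →
          (∀ j, 0 < j → j < b → j ≠ 1 → j = k - 2 ∧ b = k - 1) →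
          c (g 0) ≠ c (g b) ∧ c w' ≠ c (g b) := by
        intro b hb hcb hj
        have hu : ∀ s, g 0 < s → s < g b → s = g 1 := by
          intro s h1 h2
          obtain ⟨j, hj', rfl⟩ := D.convex 0 (by omega) b hb s h1.le h2.le
          by_contra hne
          have h3 := (D.lt_iff (by omega) hj').1 h1
          have h4 := (D.lt_iff hj' hb).1 h2
          exact h4.2 (hj j h3.1 h4.1 fun h => hne (h ▸ rfl))
        have hb0 : g b ≠ g 0 := (c1.lt.trans hcb.lt).ne'
        exact ⟨H.ne_of_unique_between c1 hcb hu, H.ne_of_unique_between c1' hcb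
          fun s h1 h2 => hu s (hbet _ (hmem b hb) hb0 s h1 h2) h2⟩
      have c3 : g 1 ⋖ g 2 := D.covBy (by omega) (by omega) (by omega) (by omega) (by omega)
      have a3 := H.adj_of_covBy _ _ c3
      have n3 := key 2 (by omega) c3 (by omega)
      rcases Nat.lt_or_ge 4 k with hk4 | hk4
      · have := D.eq_of_three_adj H le_rfl (a := 1) (by omega) (H.symm a1) (H.symm a1') a3
        tauto
      · obtain rfl : k = 4 := by omega
        have c4 : g 1 ⋖ g 3 := D.covBy (by omega) (by omega) (by omega) (by omega) (by omega)
        have a4 := H.adj_of_covBy _ _ c4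
        have n4 := key 3 (by omega) c4 (by omega)
        have n5 : c (g 2) ≠ c (g 3) := D.color_side_ne H le_rfl (by omega)
        have := H.eq_of_four_adj (H.symm a1) (H.symm a1') a3 a4
        tauto
  rcases H.comparable_of_eq _ _ hcol with hle | hle
  · exact hle.eq_or_lt.resolve_right fun hlt => c1.2 hlt c1'.lt
  · exact (hle.eq_or_lt.resolve_right fun hlt => c1'.2 hlt c1.lt).symm

theorem isDComplete : IsDComplete P where
  exists_top _ hk _ hI := H.dComplete_exists_top hk hI
  mem_of_covBy _ hk _ _ h _ hy := H.dComplete_mem_of_covBy hk h hy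
  eq_of_diff_eq _ hk _ _ _ _ hI hI' hw hw' h := H.dComplete_eq_of_diff_eq hk hI hI' hw hw' h

/-- Consecutive elements of the same colour are the ends of a double-tailed diamond. -/
theorem exists_interval : ∀ z p : P, p < z → c p = c z → (∀ q, p < q → q < z → c q ≠ c p) →
    ∃ k g, 3 ≤ k ∧ IsDiamondMap k (2 * k - 2) g ∧ g 0 = p ∧ g (2 * k - 3) = z := by
  intro z
  induction z using WellFoundedLT.induction with
  | _ z ih =>
    intro p hpz hc hn
    obtain ⟨u, v, hl⟩ := H.exists_link hpz hc hn
    obtain ⟨hpu, huz, hau⟩ := (hl.mem_iff u).2 (Or.inl rfl)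
    obtain ⟨hpv, hvz, hav⟩ := (hl.mem_iff v).2 (Or.inr rfl)
    -- An element covering `p` below `z` has an adjacent colour, hence is `u` or `v`; dually for
    -- `hupp`.
    have hlow : ∀ y, p < y → y < z → u ≤ y ∨ v ≤ y := by
      intro y h1 h2
      obtain ⟨s, hs, hsy⟩ := exists_covBy_le_of_lt h1
      rcases (hl.mem_iff s).1 ⟨hs.lt, hsy.trans_lt h2, H.symm (H.adj_of_covBy _ _ hs)⟩ with
        rfl | rfl
      exacts [Or.inl hsy, Or.inr hsy]
    have hupp : ∀ y, p < y → y < z → y ≤ u ∨ y ≤ v := by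
      intro y h1 h2
      obtain ⟨s, hys, hs⟩ := exists_le_covBy_of_lt h2
      rcases (hl.mem_iff s).1 ⟨h1.trans_le hys, hs.lt, hc.symm ▸ H.adj_of_covBy _ _ hs⟩ with
        rfl | rfl
      exacts [Or.inl hys, Or.inr hys]
    by_cases hcomp : u ≤ v ∨ v ≤ u
    · wlog huv : u ≤ v generalizing u v
      · exact this v u ⟨hl.ne.symm, fun q => (hl.mem_iff q).trans or_comm,
          hl.color.imp Eq.symm And.symm⟩ hpv hvz hav hpu huz hau
          (fun y h1 h2 => (hlow y h1 h2).symm) (fun y h1 h2 => (hupp y h1 h2).symm) hcomp.symm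
          (hcomp.resolve_left huv)
      have huv' := huv.lt_of_ne hl.ne
      have hcuv : c u = c v := hl.color.resolve_right fun h => h.1 huv
      -- Anything of the colour of `u` between `p` and `z` is itself in the link, so `u` and `v` are
      -- consecutive. Induction makes `[u, v]` a diamond, and `p` and `z` lengthen its two tails by
      -- one.
      obtain ⟨k, g, hk, D, rfl, rfl⟩ := ih v hvz u huv' hcuv fun q h1 h2 h3 => by
        rcases (hl.mem_iff q).1 ⟨hpu.trans h1, h2.trans hvz, h3.symm ▸ hau⟩ with rfl | rfl
        exacts [h1.ne rfl, h2.ne rfl]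
      have hgp : ∀ j, j < 2 * k - 2 → p < g j := fun j hj =>
        hpu.trans_le ((D.le_iff _ (by omega) _ hj).2 (by omega))
      have hgz : ∀ j, j < 2 * k - 2 → g j < z := fun j hj =>
        lt_of_le_of_lt ((D.le_iff _ hj _ (by omega)).2 (by omega)) hvz
      -- The shift by one moves the sides from `k - 2, k - 1` to `k - 1, k`, as required for
      -- parameter `k + 1`.
      let g' : ℕ → P := fun j => if j = 0 then p else if j ≤ 2 * k - 2 then g (j - 1) else z
      have hmid : ∀ j, 0 < j → j ≤ 2 * k - 2 → g' j = g (j - 1) := fun j h1 h2 => by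
        simp [g', h1.ne', h2]
      have hp0 : g' 0 = p := rfl
      have hz0 : g' (2 * (k + 1) - 3) = z := by
        simp [g', show 2 * (k + 1) - 3 ≠ 0 by omega, show ¬ 2 * (k + 1) - 3 ≤ 2 * k - 2 by omega]
      refine ⟨k + 1, g', by omega, ⟨?_, ?_⟩, hp0, hz0⟩
      · intro a ha b hb
        have ha' : a = 0 ∨ (0 < a ∧ a ≤ 2 * k - 2) ∨ a = 2 * (k + 1) - 3 := by omega
        have hb' : b = 0 ∨ (0 < b ∧ b ≤ 2 * k - 2) ∨ b = 2 * (k + 1) - 3 := by omega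
        rcases ha' with rfl | ⟨ha1, ha2⟩ | rfl <;> rcases hb' with rfl | ⟨hb1, hb2⟩ | rfl
        · simp
        · rw [hmid b hb1 hb2, hp0]
          exact iff_of_true (hgp _ (by omega)).le (by omega)
        · rw [hp0, hz0]
          exact iff_of_true hpz.le (by omega)
        · rw [hmid a ha1 ha2, hp0]
          exact iff_of_false (hgp _ (by omega)).not_ge (by omega)
        · rw [hmid a ha1 ha2, hmid b hb1 hb2, D.le_iff _ (by omega) _ (by omega)]
          omega
        · rw [hmid a ha1 ha2, hz0]
          exact iff_of_true (hgz _ (by omega)).le (by omega)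
        · rw [hp0, hz0]
          exact iff_of_false hpz.not_ge (by omega)
        · rw [hmid b hb1 hb2, hz0]
          exact iff_of_false (hgz _ (by omega)).not_ge (by omega)
        · simp
      · intro a ha b hb y hy1 hy2
        have hy1 : p ≤ y := by
          refine le_trans ?_ hy1
          obtain rfl | ⟨ha1, ha2⟩ | rfl :
            a = 0 ∨ (0 < a ∧ a ≤ 2 * k - 2) ∨ a = 2 * (k + 1) - 3 := by omega
          exacts [le_rfl, (hmid a ha1 ha2).symm ▸ (hgp _ (by omega)).le, hz0.symm ▸ hpz.le]
        have hy2 : y ≤ z := by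
          refine le_trans hy2 ?_
          obtain rfl | ⟨hb1, hb2⟩ | rfl :
            b = 0 ∨ (0 < b ∧ b ≤ 2 * k - 2) ∨ b = 2 * (k + 1) - 3 := by omega
          exacts [hpz.le, (hmid b hb1 hb2).symm ▸ (hgz _ (by omega)).le, hz0.le]
        rcases hy1.eq_or_lt with rfl | hy1
        · exact ⟨0, by omega, hp0⟩
        rcases hy2.eq_or_lt with rfl | hy2
        · exact ⟨_, by omega, hz0⟩
        obtain ⟨j, hj, rfl⟩ := D.convex 0 (by omega) (2 * k - 3) (by omega) y
          ((hlow y hy1 hy2).elim id huv.trans) ((hupp y hy1 hy2).elim (fun h => h.trans huv) id)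
        exact ⟨j + 1, by omega, hmid (j + 1) (by omega) (by omega)⟩
    -- With `u` and `v` incomparable, `p, u, v, z` form the smallest diamond.
    · push Not at hcomp
      let g : ℕ → P := fun j => if j = 0 then p else if j = 1 then u else if j = 2 then v else z
      have g0 : g 0 = p := rfl
      have g1 : g 1 = u := rfl
      have g2 : g 2 = v := rfl
      have g3 : g 3 = z := rfl
      have hall : ∀ j < 4, p ≤ g j ∧ g j ≤ z := by
        intro j hj
        interval_cases j
        exacts [⟨le_rfl, hpz.le⟩, ⟨hpu.le, huz.le⟩, ⟨hpv.le, hvz.le⟩, ⟨hpz.le, le_rfl⟩]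
      refine ⟨3, g, le_rfl, ⟨fun a ha b hb => ?_, fun a ha b hb y h1 h2 => ?_⟩, g0, g3⟩
      · interval_cases a <;> interval_cases b <;> simp only [g0, g1, g2, g3] <;>
          simp [hpz.le, hpz.not_ge, hpu.le, hpu.not_ge, hpv.le, hpv.not_ge, huz.le, huz.not_ge,
            hvz.le, hvz.not_ge, hcomp]
      · have h1 := (hall a ha).1.trans h1
        have h2 := h2.trans (hall b hb).2
        rcases h1.eq_or_lt with rfl | h1
        · exact ⟨0, by omega, rfl⟩
        rcases h2.eq_or_lt with rfl | h2
        · exact ⟨3, by omega, rfl⟩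
        rcases hlow y h1 h2 with h | h <;> rcases hupp y h1 h2 with h' | h'
        · exact ⟨1, by omega, le_antisymm h h'⟩
        · exact absurd (h.trans h') hcomp.1
        · exact absurd (h.trans h') hcomp.2
        · exact ⟨2, by omega, le_antisymm h h'⟩

end MinusculeColoring

end Coloring

/-! ### Root heights and hook lengths. -/

section Coloring

section Bond

variable {P C : Type*} {c : P → C} {adj : C → C → Prop}

open Classical in
/-- Minus the entry of the (simply laced) Cartan matrix for the colours of `x` and `y`. -/
noncomputable def bond (c : P → C) (adj : C → C → Prop) (x y : P) : ℤ :=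
  if c x = c y then -2 else if adj (c x) (c y) then 1 else 0

theorem bond_of_eq {x y : P} (adj : C → C → Prop) (h : c x = c y) : bond c adj x y = -2 := if_pos h

theorem bond_of_not {x y : P} (h1 : c x ≠ c y) (h2 : ¬ adj (c x) (c y)) : bond c adj x y = 0 := by
  rw [bond, if_neg h1, if_neg h2]

end Bond

variable {P C : Type*} [PartialOrder P] {c : P → C} {adj : C → C → Prop}

open Classical in
/-- `b p` is the height of the root attached to `p`. -/
def IsRootHeight [Fintype P] (c : P → C) (adj : C → C → Prop) (b : P → ℤ) : Prop :=
  ∀ p, b p = 1 + ∑ q, if q < p then bond c adj q p * b q else 0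

/-- The recursion comes from expanding the reflections in `β_p = s_{q_1} ⋯ s_{q_k} α_{c p}`, with
`q_1, …, q_k` the elements below `p` in a linear extension: `β_p = α_{c p} + ∑ bond q p • β_q`. -/
theorem exists_isRootHeight [Fintype P] (c : P → C) (adj : C → C → Prop) :
    ∃ b, IsRootHeight c adj b := by
  classical
  refine ⟨WellFounded.fix (r := ((· < ·) : P → P → Prop)) wellFounded_lt fun p f =>
    1 + ∑ q, if h : q < p then bond c adj q p * f q h else 0, fun p => ?_⟩
  rw [WellFounded.fix_eq]
  simp only [dite_eq_ite]

namespace MinusculeColoring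

variable (H : MinusculeColoring c adj)
include H

theorem bond_of_adj {x y : P} (h : adj (c x) (c y)) : bond c adj x y = 1 := by
  rw [bond, if_neg (H.ne_of_adj h), if_pos h]

/-- The relation between the root heights around two consecutive elements of the same colour. -/
theorem rootHeight_link [Fintype P] {b : P → ℤ} (hb : IsRootHeight c adj b) {p z u v : P}
    (hpz : p < z) (hc : c p = c z) (hn : ∀ q, p < q → q < z → c q ≠ c p)
    (hl : IsLink c adj p z u v) : b z = b u + b v - b p := by
  classical
  obtain ⟨hpu, huz, hau⟩ := (hl.mem_iff u).2 (Or.inl rfl)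
  obtain ⟨hpv, hvz, hav⟩ := (hl.mem_iff v).2 (Or.inr rfl)
  -- Bonds with `p` and with `z` agree; between the two recursions only the terms of `p`, `u`, `v`
  -- are new, with coefficients `-2, 1, 1`.
  have key : ∀ q, (if q < z then bond c adj q z * b q else 0) =
      (if q < p then bond c adj q p * b q else 0) + ((if q = p then -2 * b q else 0) +
        ((if q = u then b q else 0) + if q = v then b q else 0)) := by
    intro q
    have hbz : bond c adj q z = bond c adj q p := by simp only [bond, hc]
    rw [hbz]
    by_cases h1 : c q = c p
    · have hu : q ≠ u := by rintro rfl; exact H.ne_of_adj hau h1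
      have hv : q ≠ v := by rintro rfl; exact H.ne_of_adj hav h1
      rw [bond_of_eq adj h1]
      rcases H.comparable_of_eq q p h1 with h | h
      · rcases h.eq_or_lt with rfl | h
        · simp [hpz, hu, hv]
        · simp [h, h.trans hpz, h.ne, hu, hv]
      · rcases h.eq_or_lt with rfl | h
        · simp [hpz, hu, hv]
        · have : ¬ q < z := fun hqz => hn q h hqz h1
          simp [h.not_gt, h.ne', this, hu, hv]
    have hp : q ≠ p := by rintro rfl; exact h1 rfl
    by_cases h2 : adj (c q) (c p)
    · rw [H.bond_of_adj h2]
      rcases H.comparable_of_adj q p h2 with h | h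
      · have h := h.lt_of_ne hp
        have hu : q ≠ u := by rintro rfl; exact h.not_gt hpu
        have hv : q ≠ v := by rintro rfl; exact h.not_gt hpv
        simp [h, h.trans hpz, h.ne, hu, hv]
      · have h := h.lt_of_ne hp.symm
        by_cases hqz : q < z
        · rcases (hl.mem_iff q).1 ⟨h, hqz, h2⟩ with rfl | rfl
          · simp [hqz, h.not_gt, hp, hl.ne]
          · simp [hqz, h.not_gt, hp, hl.ne.symm]
        · have hu : q ≠ u := by rintro rfl; exact hqz huz
          have hv : q ≠ v := by rintro rfl; exact hqz hvz
          simp [hqz, h.not_gt, hp, hu, hv]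
    · have hu : q ≠ u := by rintro rfl; exact h2 hau
      have hv : q ≠ v := by rintro rfl; exact h2 hav
      rw [bond_of_not h1 h2]
      simp [hp, hu, hv]
  have e1 := hb z
  have e2 := hb p
  simp only [key, Finset.sum_add_distrib, Finset.sum_ite_eq', Finset.mem_univ, if_true] at e1
  linarith

/-- Below the bottommost element `p` of its colour, every element has, counted up to `p`, one more
adjacent element above it than twice the elements of its own colour. -/
theorem sum_bond_of_bot [Fintype P] {p : P} (hp : ∀ q, q < p → c q ≠ c p) :
    ∀ q, q < p → (∑ r, open Classical in if q < r ∧ r ≤ p then bond c adj q r else 0) = 1 := by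
  classical
  intro q
  induction q using WellFoundedGT.induction with
  | _ q ih =>
    intro hqp
    -- Passing to the next element of the colour of `q` changes the sum by `-2 + 1 + 1 = 0`. If
    -- there is none up to `p`, axiom `eq_of_bot` leaves a single element covering `q` as the only
    -- contribution.
    by_cases hex : ∃ r, q < r ∧ r ≤ p ∧ c r = c q
    · obtain ⟨r, hqr, hrp, hrc⟩ := hex
      obtain ⟨z, hqz, hzr, hzc, hn⟩ := exists_next_of_color_eq c hqr hrc
      have hzp : z < p := (hzr.trans hrp).lt_of_ne fun h => hp q hqp (hzc.symm.trans (h ▸ rfl))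
      obtain ⟨u, v, hl⟩ := H.exists_link hqz hzc.symm hn
      obtain ⟨hqu, huz, hau⟩ := (hl.mem_iff u).2 (Or.inl rfl)
      obtain ⟨hqv, hvz, hav⟩ := (hl.mem_iff v).2 (Or.inr rfl)
      have key : ∀ r, (if q < r ∧ r ≤ p then bond c adj q r else 0) =
          (if z < r ∧ r ≤ p then bond c adj z r else 0) + ((if r = z then -2 else 0) +
          ((if r = u then 1 else 0) + if r = v then 1 else 0)) := by
        intro r
        have hbz : bond c adj z r = bond c adj q r := by simp only [bond, hzc]
        rw [hbz]
        by_cases h1 : c q = c r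
        · have hu : r ≠ u := by rintro rfl; exact H.ne_of_adj hau h1.symm
          have hv : r ≠ v := by rintro rfl; exact H.ne_of_adj hav h1.symm
          rw [bond_of_eq adj h1]
          rcases eq_or_ne r z with rfl | hrz
          · simp [hqz, hu, hv, hzp.le]
          · have : q < r ↔ z < r := by
              refine ⟨fun h => ?_, hqz.trans⟩
              rcases H.comparable_of_eq z r (hzc.trans h1) with h' | h'
              · exact h'.lt_of_ne hrz.symm
              · exact absurd h1.symm (hn r h (h'.lt_of_ne hrz))
            simp [this, hrz, hu, hv]
        have hz : r ≠ z := by rintro rfl; exact h1 hzc.symm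
        by_cases h2 : adj (c q) (c r)
        · rw [H.bond_of_adj h2]
          by_cases hruv : r = u ∨ r = v
          · rcases hruv with rfl | rfl
            · simp [hqu, huz.not_gt, (huz.trans hzp).le, hz, hl.ne]
            · simp [hqv, hvz.not_gt, (hvz.trans hzp).le, hz, hl.ne.symm]
          · have : q < r ↔ z < r := by
              refine ⟨fun h => ?_, hqz.trans⟩
              rcases H.comparable_of_adj z r (hzc.symm ▸ h2) with h' | h'
              · exact h'.lt_of_ne hz.symm
              · exact absurd ((hl.mem_iff r).1 ⟨h, h'.lt_of_ne hz, H.symm h2⟩) hruv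
            rw [not_or] at hruv
            simp [this, hz, hruv]
        · have hu : r ≠ u := by rintro rfl; exact h2 (H.symm hau)
          have hv : r ≠ v := by rintro rfl; exact h2 (H.symm hav)
          rw [bond_of_not h1 h2]
          simp [hz, hu, hv]
      simp only [key, Finset.sum_add_distrib, Finset.sum_ite_eq', Finset.mem_univ, if_true,
        ih z hqz hzp]
      norm_num
    · push Not at hex
      obtain ⟨s, hs, hsp⟩ := exists_covBy_le_of_lt hqp
      have has := H.adj_of_covBy _ _ hs
      have key : ∀ r, (if q < r ∧ r ≤ p then bond c adj q r else 0) =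
          (if r = s then 1 else 0) := by
        intro r
        rcases eq_or_ne r s with rfl | hrs
        · simp [hs.lt, hsp, H.bond_of_adj has]
        · by_cases h : q < r ∧ r ≤ p
          · rw [if_pos h, if_neg hrs, bond_of_not (hex r h.1 h.2).symm]
            intro h2
            exact hrs (H.eq_of_bot p hp q hqp hex r s h.1 h.2 hs.lt hsp (H.symm h2) (H.symm has))
          · rw [if_neg h, if_neg hrs]
      simp [key]

/-- The root height of a bottommost element of its colour is the number of elements below it. -/
theorem rootHeight_of_bot [Fintype P] {b : P → ℤ} (hb : IsRootHeight c adj b) {p : P}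
    (hp : ∀ q, q < p → c q ≠ c p) : b p = Nat.card (Set.Iic p) := by
  classical
  have h1 : (Nat.card (Set.Iic p) : ℤ) = ∑ r, if r ≤ p then 1 else 0 := by
    rw [Nat.card_eq_fintype_card, Fintype.card_subtype, Finset.card_filter]
    push_cast
    simp
  -- This is the recursion solved for `1`. After exchanging the sums every `b q` with `q < p` is
  -- subtracted exactly once, so only `b p` survives.
  have h2 : ∀ r, (if r ≤ p then (1 : ℤ) else 0) = (if r ≤ p then b r else 0) -
      ∑ q, b q * if q < r ∧ r ≤ p then bond c adj q r else 0 := by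
    intro r
    by_cases hr : r ≤ p
    · have h := hb r
      have e : ∀ q, (b q * if q < r ∧ r ≤ p then bond c adj q r else 0) =
          if q < r then bond c adj q r * b q else 0 := by
        intro q
        by_cases hq : q < r <;> simp [hq, hr, mul_comm]
      rw [if_pos hr, if_pos hr, Finset.sum_congr rfl fun q _ => e q]
      linarith
    · simp [hr]
  have h3 : ∀ q, (b q * ∑ r, if q < r ∧ r ≤ p then bond c adj q r else 0) =
      if q < p then b q else 0 := by
    intro q
    by_cases hq : q < p
    · rw [H.sum_bond_of_bot hp q hq, if_pos hq, mul_one]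
    · rw [if_neg hq, Finset.sum_eq_zero, mul_zero]
      intro r _
      exact if_neg fun h => hq (h.1.trans_le h.2)
  have h4 : ∀ r, (if r ≤ p then b r else 0) = (if r < p then b r else 0) + if r = p then b r else 0 := by
    intro r
    rcases eq_or_ne r p with rfl | h
    · simp
    · simp [h, le_iff_lt_or_eq]
  rw [h1, Finset.sum_congr rfl fun r _ => h2 r, Finset.sum_sub_distrib, Finset.sum_comm]
  simp only [← Finset.mul_sum, h3, h4, Finset.sum_add_distrib]
  simp

/-- Elements that are not bottommost of their colour are tops of diamonds, reaching down to the
preceding element of that colour; `exists_lt_of_inNeck` is the converse. -/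
theorem exists_interval_of_not_bot [Finite P] {z q : P} (hq : q < z) (hc : c q = c z) :
    ∃ k p x y, 3 ≤ k ∧ IsDInterval k p z ∧ InNeck k p z z ∧ p < z ∧ x < z ∧ y < z ∧ p ≤ x ∧ p ≤ y ∧
      ¬ x ≤ y ∧ ¬ y ≤ x := by
  obtain ⟨p, u, v, hp, hpc, hmax, -⟩ := H.exists_pred q z hq hc
  obtain ⟨k, g, hk, D, rfl, rfl⟩ := H.exists_interval z p hp hpc fun s h1 h2 h3 =>
    absurd (hmax s h2 (h3.trans hpc)) h1.not_ge
  have hI := D.isDInterval hk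
  refine ⟨k, g 0, g (k - 2), g (k - 1), hk, hI, ?_, hp, ?_, ?_, ?_, ?_, ?_, ?_⟩
  · obtain ⟨e⟩ := hI
    refine ⟨e, ⟨hp.le, le_rfl⟩, ?_⟩
    by_contra hlt
    -- The isomorphism `e` need not come from `g`, but it must send the greatest element to the
    -- greatest position.
    have hmem : e ⟨g (2 * k - 3), hp.le, le_rfl⟩ ≥ ⟨⟨2 * k - 3, by omega⟩⟩ := by
      obtain ⟨t, ht⟩ := e.surjective ⟨⟨2 * k - 3, by omega⟩⟩
      rw [← ht]
      exact e.monotone t.2.2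
    rcases hmem with h | h
    · rw [← h] at hlt
      simp at hlt
      omega
    · have := h.1
      rw [Fin.lt_def] at this
      simp at this
      omega
  all_goals first | rw [D.lt_iff (by omega) (by omega)] | rw [D.le_iff _ (by omega) _ (by omega)]
  all_goals omega

/-- Neck position `j` is mirrored by position `2k - 3 - j`, which lies lower and has the same
colour. -/
theorem exists_lt_of_inNeck [Finite P] {k : ℕ} (hk : 3 ≤ k) {w t z : P} (h : InNeck k w t z) :
    ∃ q, q < z ∧ c q = c z := by
  obtain ⟨e, hz, hkz⟩ := h
  obtain ⟨g, D, rfl, rfl, hval⟩ := exists_map_of_orderIso hk e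
  have hj := (e ⟨z, hz⟩).pos.2
  have hg := hval z hz
  generalize (e ⟨z, hz⟩).pos.val = j at hj hg hkz
  subst hg
  refine ⟨g (2 * k - 3 - j), ?_, ?_⟩
  · rw [D.lt_iff (by omega) (by omega)]
    omega
  · have := D.color_neck H (by omega) le_rfl hk (j - (k - 1)) (by omega) (by omega)
    rw [show k - 1 + (j - (k - 1)) = j by omega,
      show k - 2 - (j - (k - 1)) = 2 * k - 3 - j by omega] at this
    exact this.symm

/-- In a double-tailed diamond, the root heights of two elements in opposite positions have the
same sum as those of the two sides. -/
theorem rootHeight_neck [Fintype P] {b : P → ℤ} (hb : IsRootHeight c adj b) {k : ℕ} (hk : 3 ≤ k)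
    {g : ℕ → P} (D : IsDiamondMap k (2 * k - 2) g) :
    ∀ j, j ≤ k - 2 → b (g (k - 1 + j)) + b (g (k - 2 - j)) = b (g (k - 2)) + b (g (k - 1)) := by
  intro j
  induction j with
  | zero => intro _; exact add_comm _ _
  | succ j ih =>
    intro hj
    have e1 := D.color_neck H (by omega) le_rfl hk (j + 1) (by omega) (by omega)
    have hlt : g (k - 2 - (j + 1)) < g (k - 1 + (j + 1)) := by
      rw [D.lt_iff (by omega) (by omega)]
      omega
    have hn : ∀ q, g (k - 2 - (j + 1)) < q → q < g (k - 1 + (j + 1)) →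
        c q ≠ c (g (k - 2 - (j + 1))) := by
      intro q h1 h2
      obtain ⟨i, hi, rfl⟩ := D.convex _ (by omega) _ (by omega) q h1.le h2.le
      rw [D.lt_iff (by omega) hi] at h1
      rw [D.lt_iff hi (by omega)] at h2
      exact D.color_ne_between H (by omega) le_rfl hk (by omega) h1.1 (by omega)
    obtain ⟨u, v, hl⟩ := H.exists_link hlt e1.symm hn
    have c1 : g (k - 2 - (j + 1)) ⋖ g (k - 2 - j) :=
      D.covBy (by omega) (by omega) (by omega) (by omega) (by omega)
    have c2 : g (k - 1 + j) ⋖ g (k - 1 + (j + 1)) :=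
      D.covBy (by omega) (by omega) (by omega) (by omega) (by omega)
    have hne : g (k - 2 - j) ≠ g (k - 1 + j) := fun h => by
      have := D.inj (by omega) (by omega) h
      omega
    -- The next positions inwards on both sides occupy the link, so `rootHeight_link` preserves the
    -- sum of opposite heights.
    have m1 := (hl.mem_iff _).1 ⟨c1.lt, H.lt_of_covBy_of_eq c1 hlt e1.symm,
      H.symm (H.adj_of_covBy _ _ c1)⟩
    have m2 := (hl.mem_iff _).1 ⟨H.lt_of_eq_of_covBy c2 hlt e1.symm, c2.lt,
      e1 ▸ H.adj_of_covBy _ _ c2⟩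
    have e2 := H.rootHeight_link hb hlt e1.symm hn hl
    have e3 := ih (by omega)
    have e4 : b (g (k - 2 - j)) + b (g (k - 1 + j)) = b u + b v := by
      rcases m1 with m1 | m1 <;> rcases m2 with m2 | m2 <;> rw [m1, m2]
      · exact absurd (m1.trans m2.symm) hne
      · exact add_comm _ _
      · exact absurd (m1.trans m2.symm) hne
    linarith

/-- An element in no neck is bottommost of its colour, where the root height counts elements. For an
interval, the sum over opposite positions is evaluated at the two ends. -/
theorem isHookLength [Fintype P] {b : P → ℤ} (hb : IsRootHeight c adj b) {h : P → ℕ}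
    (hh : ∀ p, (h p : ℤ) = b p) : IsHookLength h where
  of_not_neck z hz := by
    have := H.rootHeight_of_bot hb (p := z) fun q hq hc => by
      obtain ⟨k, p, x, y, hk, -, hn, -⟩ := H.exists_interval_of_not_bot hq hc
      exact hz k hk _ _ hn
    rw [← hh] at this
    exact_mod_cast this
  of_interval l hl w z hI x hx y hy hxy hyx := by
    obtain ⟨e⟩ := hI
    obtain ⟨g, D, rfl, rfl, hval⟩ := exists_map_of_orderIso hl e
    obtain ⟨i, hi, rfl⟩ := D.convex 0 (by omega) _ (by omega) x hx.1 hx.2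
    obtain ⟨j, hj, rfl⟩ := D.convex 0 (by omega) _ (by omega) y hy.1 hy.2
    rw [D.le_iff _ hi _ hj] at hxy
    rw [D.le_iff _ hj _ hi] at hyx
    have := H.rootHeight_neck hb hl D (l - 2) le_rfl
    rw [show l - 1 + (l - 2) = 2 * l - 3 by omega, Nat.sub_self] at this
    simp only [hh]
    obtain ⟨rfl, rfl⟩ | ⟨rfl, rfl⟩ : (i = l - 2 ∧ j = l - 1) ∨ (i = l - 1 ∧ j = l - 2) := by omega
    all_goals linarith

/-- Every element falls under one of the two clauses, and the second refers only to smaller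
elements. -/
theorem hookLength_unique [Finite P] {h h' : P → ℕ} (hh : IsHookLength h) (hh' : IsHookLength h') :
    h' = h := by
  funext z
  induction z using WellFoundedLT.induction with
  | _ z ih =>
    by_cases hex : ∃ q, q < z ∧ c q = c z
    · obtain ⟨q, hq, hc⟩ := hex
      obtain ⟨k, p, x, y, hk, hI, -, hpz, hxz, hyz, hpx, hpy, hxy, hyx⟩ :=
        H.exists_interval_of_not_bot hq hc
      have e1 := hh.of_interval k hk p z hI x ⟨hpx, hxz.le⟩ y ⟨hpy, hyz.le⟩ hxy hyx
      have e2 := hh'.of_interval k hk p z hI x ⟨hpx, hxz.le⟩ y ⟨hpy, hyz.le⟩ hxy hyx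
      rw [ih x hxz, ih y hyz, ih p hpz] at e2
      exact_mod_cast e2.trans e1.symm
    · have hn : ∀ k, 3 ≤ k → ∀ w t, ¬ InNeck k w t z := fun k hk w t hn =>
        hex (H.exists_lt_of_inNeck hk hn)
      rw [hh.of_not_neck z hn, hh'.of_not_neck z hn]

end MinusculeColoring

end Coloring

/-! ### Weights, toggles and the removal of minimal elements. -/

section Weight

variable {P C : Type*} {c : P → C} {adj : C → C → Prop}

/-- The weights left on the colours once the elements outside `G` have been removed. -/
noncomputable def colorWeight [Fintype P] [DecidableEq P] (c : P → C) (adj : C → C → Prop) (b : P → ℤ)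
    (G : Finset P) (x : P) : ℤ :=
  1 + ∑ q, if q ∈ G then 0 else bond c adj q x * b q

theorem colorWeight_erase [Fintype P] [DecidableEq P] {F : Finset P} {p : P} (b : P → ℤ) (hp : p ∈ F) (x : P) :
    colorWeight c adj b (F.erase p) x = colorWeight c adj b F x + bond c adj p x * b p := by
  have key : ∀ q, (if q ∈ F.erase p then 0 else bond c adj q x * b q) =
      (if q ∈ F then 0 else bond c adj q x * b q) + if q = p then bond c adj q x * b q else 0 := by
    intro q
    rcases eq_or_ne q p with rfl | h
    · simp [hp]
    · simp [h]
  simp only [colorWeight]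
  rw [Finset.sum_congr rfl fun q _ => key q, Finset.sum_add_distrib]
  simp [add_assoc]

end Weight

section Toggle

variable {P C : Type*} [PartialOrder P] {c : P → C} {adj : C → C → Prop}

/-- `σ` is order reversing on `G` along pairs of adjacent colours, and vanishes off `G`. -/
structure IsPartitionOn (c : P → C) (adj : C → C → Prop) (G : Finset P) (σ : P → ℕ) : Prop where
  le : ∀ x ∈ G, ∀ y ∈ G, x < y → adj (c x) (c y) → σ y ≤ σ x
  zero : ∀ x ∉ G, σ x = 0

/-- The least value allowed at `x` by the values of `σ` above `x`. -/
noncomputable def lowerBound [Fintype P] (c : P → C) (adj : C → C → Prop) (σ : P → ℕ) (x : P) : ℕ :=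
  open Classical in (Finset.univ.filter fun y => x < y ∧ adj (c y) (c x)).sup σ

/-- The largest value allowed at `x` by the values of `σ` on the elements of `G` below `x`. -/
noncomputable def upperBound (c : P → C) (adj : C → C → Prop) (G : Finset P) (σ : P → ℕ) (x : P) :
    ℕ :=
  sInf (σ '' {y | y ∈ G ∧ y < x ∧ adj (c y) (c x)})

open Classical in
/-- Reflect the values of `σ` at the elements of `G` of colour `i` in the intervals allowed by the
other values. -/
noncomputable def toggle [Fintype P] (c : P → C) (adj : C → C → Prop) (G : Finset P) (i : C)
    (σ : P → ℕ) (x : P) : ℕ :=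
  if x ∈ G ∧ c x = i then lowerBound c adj σ x + upperBound c adj G σ x - σ x else σ x

theorem le_lowerBound [Fintype P] {σ : P → ℕ} {x y : P} (h : x < y) (ha : adj (c y) (c x)) :
    σ y ≤ lowerBound c adj σ x := by
  classical
  exact Finset.le_sup (f := σ) (by simp [h, ha])

theorem lowerBound_le [Fintype P] {σ : P → ℕ} {x : P} {n : ℕ}
    (h : ∀ y, x < y → adj (c y) (c x) → σ y ≤ n) : lowerBound c adj σ x ≤ n := by
  classical
  refine Finset.sup_le fun y hy => ?_
  simp only [Finset.mem_filter, Finset.mem_univ, true_and] at hy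
  exact h y hy.1 hy.2

theorem upperBound_le {G : Finset P} {σ : P → ℕ} {x y : P} (hy : y ∈ G) (h : y < x)
    (ha : adj (c y) (c x)) : upperBound c adj G σ x ≤ σ y :=
  Nat.sInf_le ⟨y, ⟨hy, h, ha⟩, rfl⟩

theorem le_upperBound {G : Finset P} {σ : P → ℕ} {x : P} {n : ℕ}
    (hne : ∃ y ∈ G, y < x ∧ adj (c y) (c x))
    (h : ∀ y ∈ G, y < x → adj (c y) (c x) → n ≤ σ y) : n ≤ upperBound c adj G σ x := by
  obtain ⟨y, hy⟩ := hne
  obtain ⟨z, ⟨h1, h2, h3⟩, hz⟩ := Nat.sInf_mem (s := σ '' {y | y ∈ G ∧ y < x ∧ adj (c y) (c x)})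
    ⟨_, y, hy, rfl⟩
  rw [upperBound, ← hz]
  exact h z h1 h2 h3

namespace MinusculeColoring

variable (H : MinusculeColoring c adj)
include H

theorem lowerBound_congr [Fintype P] {σ τ : P → ℕ} {x : P} (h : ∀ y, c y ≠ c x → σ y = τ y) :
    lowerBound c adj σ x = lowerBound c adj τ x := by
  classical
  refine Finset.sup_congr rfl fun y hy => h y ?_
  simp only [Finset.mem_filter, Finset.mem_univ, true_and] at hy
  exact H.ne_of_adj hy.2

theorem upperBound_congr {G : Finset P} {σ τ : P → ℕ} {x : P} (h : ∀ y, c y ≠ c x → σ y = τ y) :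
    upperBound c adj G σ x = upperBound c adj G τ x := by
  rw [upperBound, upperBound]
  congr 1
  exact Set.image_congr fun y hy => h y (H.ne_of_adj hy.2.2)

/-- For `x` above `p` of the same colour the set defining `upperBound` is nonempty, so the default
value `sInf ∅ = 0` does not interfere. -/
theorem exists_lower [Finite P] {F : Finset P} {p : P} (hF : IsUpperSet (F : Set P)) (hp : p ∈ F)
    {x : P} (hpx : p < x) (hc : c x = c p) : ∃ y ∈ F, p < y ∧ y < x ∧ adj (c y) (c x) := by
  obtain ⟨s, -, hs⟩ := exists_le_covBy_of_lt hpx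
  have hps := H.lt_of_eq_of_covBy hs hpx hc.symm
  exact ⟨s, hF hps.le hp, hps, hs.lt, H.adj_of_covBy _ _ hs⟩

variable [DecidableEq P] {F : Finset P} {p : P}

theorem lt_of_color_eq (hmin : ∀ q ∈ F, ¬ q < p) {x : P} (hx : x ∈ F.erase p) (hc : c x = c p) :
    p < x := by
  rw [Finset.mem_erase] at hx
  rcases H.comparable_of_eq x p hc with h | h
  · exact absurd (h.lt_of_ne hx.1) (hmin x hx.2)
  · exact h.lt_of_ne hx.1.symm

variable [Fintype P]

/-- This makes the truncated subtraction in `toggle` genuine and keeps the reflected value in the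
allowed interval. -/
theorem bounds (hF : IsUpperSet (F : Set P)) (hp : p ∈ F) (hmin : ∀ q ∈ F, ¬ q < p) {σ : P → ℕ}
    (hσ : IsPartitionOn c adj (F.erase p) σ) {x : P} (hx : x ∈ F.erase p) (hc : c x = c p) :
    lowerBound c adj σ x ≤ σ x ∧ σ x ≤ upperBound c adj (F.erase p) σ x := by
  have hpx := H.lt_of_color_eq hmin hx hc
  constructor
  · refine lowerBound_le fun y hxy ha => hσ.le x hx y ?_ hxy (H.symm ha)
    exact Finset.mem_erase.2 ⟨(hpx.trans hxy).ne', hF (hpx.trans hxy).le hp⟩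
  · obtain ⟨y, hy, hpy, hyx, ha⟩ := H.exists_lower hF hp hpx hc
    refine le_upperBound ⟨y, Finset.mem_erase.2 ⟨hpy.ne', hy⟩, hyx, ha⟩ fun y hy hyx ha => ?_
    exact hσ.le y hy x hx hyx ha

/-- Between consecutive elements `x < z` of the colour there are two neighbours `u, v`. The larger
of their values is the lower bound at `x`, the smaller is the upper bound at `z`, and `max + min` is
their sum. Above the topmost element at most one neighbour remains, and its value, or `0`, is the
lower bound there. -/
theorem sum_adj_eq (hF : IsUpperSet (F : Set P)) (hp : p ∈ F) (hmin : ∀ q ∈ F, ¬ q < p)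
    {σ : P → ℕ} (hσ : IsPartitionOn c adj (F.erase p) σ) : ∀ x, p ≤ x → c x = c p →
    (∑ q, open Classical in if x < q ∧ adj (c q) (c x) then σ q else 0) =
      lowerBound c adj σ x + ∑ y, open Classical in if x < y ∧ c y = c x then
        lowerBound c adj σ y + upperBound c adj (F.erase p) σ y else 0 := by
  classical
  have hG : ∀ {y}, p < y → y ∈ F.erase p := fun h => Finset.mem_erase.2 ⟨h.ne', hF h.le hp⟩
  intro x
  induction x using WellFoundedGT.induction with
  | _ x ih =>
    intro hpx hc
    by_cases hex : ∃ y, x < y ∧ c y = c x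
    · obtain ⟨y, hy, hyc⟩ := hex
      obtain ⟨z, hxz, -, hzc, hn⟩ := exists_next_of_color_eq c hy hyc
      obtain ⟨u, v, hl⟩ := H.exists_link hxz hzc.symm hn
      obtain ⟨hxu, huz, hau⟩ := (hl.mem_iff u).2 (Or.inl rfl)
      obtain ⟨hxv, hvz, hav⟩ := (hl.mem_iff v).2 (Or.inr rfl)
      have hz := ih z hxz (hpx.trans hxz.le) (hzc.trans hc)
      have hzG := hG (hpx.trans_lt hxz)
      have huG := hG (hpx.trans_lt hxu)
      have hvG := hG (hpx.trans_lt hxv)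
      have hdis : ∀ q, x < q → adj (c q) (c x) → (q = u ∨ q = v) ∨ z < q := by
        intro q h1 h2
        rcases H.comparable_of_adj q z (hzc.symm ▸ h2) with h | h
        · refine Or.inl ((hl.mem_iff q).1 ⟨h1, h.lt_of_ne ?_, h2⟩)
          rintro rfl
          exact H.ne_of_adj h2 hzc
        · refine Or.inr (h.lt_of_ne ?_)
          rintro rfl
          exact H.ne_of_adj h2 hzc
      have k1 : ∀ q, (if x < q ∧ adj (c q) (c x) then σ q else 0) =
          ((if q = u then σ q else 0) + if q = v then σ q else 0) +
            if z < q ∧ adj (c q) (c z) then σ q else 0 := by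
        intro q
        rw [hzc]
        by_cases h : q = u ∨ q = v
        · rcases h with rfl | rfl
          · simp [hxu, hau, huz.not_gt, hl.ne]
          · simp [hxv, hav, hvz.not_gt, hl.ne.symm]
        · have : (x < q ∧ adj (c q) (c x)) ↔ (z < q ∧ adj (c q) (c x)) :=
            ⟨fun h' => ⟨(hdis q h'.1 h'.2).resolve_left h, h'.2⟩, fun h' => ⟨hxz.trans h'.1, h'.2⟩⟩
          rw [not_or] at h
          simp [this, h]
      have k2 : ∀ y, (if x < y ∧ c y = c x then
          lowerBound c adj σ y + upperBound c adj (F.erase p) σ y else 0) =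
          (if y = z then lowerBound c adj σ y + upperBound c adj (F.erase p) σ y else 0) +
          if z < y ∧ c y = c z then
            lowerBound c adj σ y + upperBound c adj (F.erase p) σ y else 0 := by
        intro y
        rw [hzc]
        rcases eq_or_ne y z with rfl | hyz
        · simp [hxz, hzc]
        · have : (x < y ∧ c y = c x) ↔ (z < y ∧ c y = c x) := by
            refine ⟨fun h' => ⟨?_, h'.2⟩, fun h' => ⟨hxz.trans h'.1, h'.2⟩⟩
            rcases H.comparable_of_eq y z (h'.2.trans hzc.symm) with h | h
            · exact absurd h'.2 (hn y h'.1 (h.lt_of_ne hyz))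
            · exact h.lt_of_ne hyz.symm
          simp [this, hyz]
      have e1 : lowerBound c adj σ x = max (σ u) (σ v) := by
        apply le_antisymm
        · refine lowerBound_le fun q h1 h2 => ?_
          rcases hdis q h1 h2 with (rfl | rfl) | h
          · exact le_max_left _ _
          · exact le_max_right _ _
          · exact (hσ.le z hzG q (hG (hpx.trans_lt h1)) h (hzc.symm ▸ H.symm h2)).trans
              ((hσ.le u huG z hzG huz (hzc.symm ▸ hau)).trans (le_max_left _ _))
        · exact max_le (le_lowerBound hxu hau) (le_lowerBound hxv hav)
      have e2 : upperBound c adj (F.erase p) σ z = min (σ u) (σ v) := by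
        apply le_antisymm
        · exact le_min (upperBound_le huG huz (hzc.symm ▸ hau))
            (upperBound_le hvG hvz (hzc.symm ▸ hav))
        · refine le_upperBound ⟨u, huG, huz, hzc.symm ▸ hau⟩ fun q hq h1 h2 => ?_
          rw [hzc] at h2
          have hqx : q ≠ x := fun h => H.ne_of_adj h2 (h ▸ rfl)
          rcases H.comparable_of_adj q x h2 with h | h
          · have h := h.lt_of_ne hqx
            rcases hpx.eq_or_lt with rfl | hpx
            · exact absurd h (hmin q (Finset.mem_of_mem_erase hq))
            · exact (min_le_left _ _).trans ((hσ.le x (hG hpx) u huG hxu (H.symm hau)).trans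
                (hσ.le q hq x (hG hpx) h h2))
          · rcases (hl.mem_iff q).1 ⟨h.lt_of_ne hqx.symm, h1, h2⟩ with rfl | rfl
            exacts [min_le_left _ _, min_le_right _ _]
      have e3 := max_add_min (σ u) (σ v)
      simp only [k1, k2, Finset.sum_add_distrib, Finset.sum_ite_eq', Finset.mem_univ, if_true,
        hz, e1, e2]
      omega
    · push Not at hex
      have k2 : ∀ y, (if x < y ∧ c y = c x then
          lowerBound c adj σ y + upperBound c adj (F.erase p) σ y else 0) = 0 :=
        fun y => if_neg fun h => hex y h.1 h.2
      simp only [k2, Finset.sum_const_zero, add_zero]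
      by_cases hq : ∃ q, x < q ∧ adj (c q) (c x)
      · obtain ⟨q, h1, h2⟩ := hq
        have hu : ∀ y, x < y → adj (c y) (c x) → y = q := fun y h3 h4 =>
          H.eq_of_top x hex y q h3 h1 h4 h2
        rw [Finset.sum_eq_single q (fun y _ hy => if_neg fun h => hy (hu y h.1 h.2))
          (fun h => absurd (Finset.mem_univ q) h), if_pos ⟨h1, h2⟩]
        refine le_antisymm (le_lowerBound h1 h2) (lowerBound_le fun y h3 h4 => ?_)
        rw [hu y h3 h4]
      · push Not at hq
        rw [Finset.sum_eq_zero fun y _ => if_neg fun h => hq y h.1 h.2]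
        exact (Nat.le_zero.1 (lowerBound_le fun y h3 h4 => absurd h4 (hq y h3))).symm

end MinusculeColoring

end Toggle

section Toggle

variable {P C : Type*} [PartialOrder P] {c : P → C} {adj : C → C → Prop}

theorem toggle_of_ne [Fintype P] {G : Finset P} {i : C} {σ : P → ℕ} {x : P} (h : c x ≠ i) :
    toggle c adj G i σ x = σ x := if_neg fun h' => h h'.2

theorem toggle_of_mem [Fintype P] {G : Finset P} {i : C} {σ : P → ℕ} {x : P} (hx : x ∈ G) (h : c x = i) :
    toggle c adj G i σ x = lowerBound c adj σ x + upperBound c adj G σ x - σ x :=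
  if_pos ⟨hx, h⟩

theorem IsPartitionOn.update_zero [DecidableEq P] {F : Finset P} {p : P} {σ : P → ℕ} (hσ : IsPartitionOn c adj F σ) :
    IsPartitionOn c adj (F.erase p) (Function.update σ p 0) where
  le x hx y hy hxy ha := by
    rw [Finset.mem_erase] at hx hy
    rw [Function.update_of_ne hx.1, Function.update_of_ne hy.1]
    exact hσ.le x hx.2 y hy.2 hxy ha
  zero x hx := by
    rcases eq_or_ne x p with rfl | h
    · simp
    · rw [Function.update_of_ne h]
      exact hσ.zero x fun h' => hx (Finset.mem_erase.2 ⟨h, h'⟩)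

namespace MinusculeColoring

variable (H : MinusculeColoring c adj)
include H

variable [Fintype P] [DecidableEq P] {F : Finset P} {p : P}

theorem toggle_isPartitionOn (hF : IsUpperSet (F : Set P)) (hp : p ∈ F) (hmin : ∀ q ∈ F, ¬ q < p)
    {σ : P → ℕ} (hσ : IsPartitionOn c adj (F.erase p) σ) :
    IsPartitionOn c adj (F.erase p) (toggle c adj (F.erase p) (c p) σ) where
  le x hx y hy hxy ha := by
    by_cases h1 : c x = c p
    · have h2 : c y ≠ c p := fun h => H.ne_of_adj ha (h1.trans h.symm)
      have := H.bounds hF hp hmin hσ hx h1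
      have := le_lowerBound (σ := σ) hxy (H.symm ha)
      rw [toggle_of_ne h2, toggle_of_mem hx h1]
      omega
    · rw [toggle_of_ne h1]
      by_cases h2 : c y = c p
      · have := H.bounds hF hp hmin hσ hy h2
        have := upperBound_le (σ := σ) hx hxy ha
        rw [toggle_of_mem hy h2]
        omega
      · rw [toggle_of_ne h2]
        exact hσ.le x hx y hy hxy ha
  zero x hx := by
    rw [toggle, if_neg fun h => hx h.1, hσ.zero x hx]

/-- The bounds at an element depend only on values at other colours, which the toggle does not
change. -/
theorem toggle_toggle (hF : IsUpperSet (F : Set P)) (hp : p ∈ F) (hmin : ∀ q ∈ F, ¬ q < p)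
    {σ : P → ℕ} (hσ : IsPartitionOn c adj (F.erase p) σ) :
    toggle c adj (F.erase p) (c p) (toggle c adj (F.erase p) (c p) σ) = σ := by
  funext x
  by_cases h : x ∈ F.erase p ∧ c x = c p
  · have := H.bounds hF hp hmin hσ h.1 h.2
    have hne : ∀ y, c y ≠ c x → toggle c adj (F.erase p) (c p) σ y = σ y := fun y hy =>
      toggle_of_ne (h.2 ▸ hy)
    rw [toggle_of_mem h.1 h.2, H.lowerBound_congr hne, H.upperBound_congr hne,
      toggle_of_mem h.1 h.2]
    omega
  · rw [toggle, if_neg h, toggle, if_neg h]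

/-- Nothing in `F` lies below `p`, so the value at `p` is only bounded from below. -/
theorem isPartitionOn_update (hp : p ∈ F) (hmin : ∀ q ∈ F, ¬ q < p)
    {σ : P → ℕ} (hσ : IsPartitionOn c adj (F.erase p) σ) (m : ℕ) :
    IsPartitionOn c adj F (Function.update σ p (m + lowerBound c adj σ p)) where
  le x hx y hy hxy ha := by
    have hyp : y ≠ p := by rintro rfl; exact hmin x hx hxy
    rw [Function.update_of_ne hyp]
    rcases eq_or_ne x p with rfl | h
    · rw [Function.update_self]
      exact (le_lowerBound hxy (H.symm ha)).trans (Nat.le_add_left _ _)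
    · rw [Function.update_of_ne h]
      exact hσ.le x (Finset.mem_erase.2 ⟨h, hx⟩) y (Finset.mem_erase.2 ⟨hyp, hy⟩) hxy ha
  zero x hx := by
    have h : x ≠ p := by rintro rfl; exact hx hp
    rw [Function.update_of_ne h]
    exact hσ.zero x fun h' => hx (Finset.mem_of_mem_erase h')

/-- Removing a minimal element `p` and toggling its colour. -/
noncomputable def toggleEquiv (hF : IsUpperSet (F : Set P)) (hp : p ∈ F)
    (hmin : ∀ q ∈ F, ¬ q < p) : {σ // IsPartitionOn c adj F σ} ≃
      ℕ × {σ // IsPartitionOn c adj (F.erase p) σ} where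
  toFun σ := (σ.1 p - lowerBound c adj σ.1 p,
    ⟨toggle c adj (F.erase p) (c p) (Function.update σ.1 p 0),
      H.toggle_isPartitionOn hF hp hmin σ.2.update_zero⟩)
  invFun τ := ⟨Function.update (toggle c adj (F.erase p) (c p) τ.2.1) p
      (τ.1 + lowerBound c adj (toggle c adj (F.erase p) (c p) τ.2.1) p),
    H.isPartitionOn_update hp hmin (H.toggle_isPartitionOn hF hp hmin τ.2.2) τ.1⟩
  left_inv σ := by
    -- The truncated difference stored in the first component therefore loses nothing.
    have hle : lowerBound c adj σ.1 p ≤ σ.1 p := lowerBound_le fun y hy ha =>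
      σ.2.le p hp y (hF hy.le hp) hy (H.symm ha)
    have hne : ∀ y, c y ≠ c p → Function.update σ.1 p 0 y = σ.1 y := fun y hy =>
      Function.update_of_ne (by rintro rfl; exact hy rfl) _ _
    ext1
    simp only [H.toggle_toggle hF hp hmin σ.2.update_zero]
    rw [H.lowerBound_congr hne, Function.update_idem, Nat.sub_add_cancel hle,
      Function.update_eq_self]
  right_inv τ := by
    obtain ⟨m, τ, hτ⟩ := τ
    have ht := H.toggle_isPartitionOn hF hp hmin hτ
    have hne : ∀ y, c y ≠ c p → ∀ n, Function.update (toggle c adj (F.erase p) (c p) τ) p n y =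
        toggle c adj (F.erase p) (c p) τ y := fun y hy n =>
      Function.update_of_ne (by rintro rfl; exact hy rfl) _ _
    have h0 : toggle c adj (F.erase p) (c p) τ p = 0 := ht.zero p (Finset.notMem_erase p F)
    simp only [Prod.mk.injEq, Subtype.mk.injEq]
    constructor
    · rw [H.lowerBound_congr fun y hy => hne y hy _, Function.update_self, Nat.add_sub_cancel]
    · rw [Function.update_idem, Function.update_eq_self_iff.2 h0.symm,
        H.toggle_toggle hF hp hmin hτ]

/-- An element outside `F` with nonzero bond to `p` is comparable with `p` and cannot be above it,
while everything below `p` is outside `F`. The weight is therefore exactly the recursion for `b p`.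
-/
theorem colorWeight_min {b : P → ℤ} (hb : IsRootHeight c adj b) (hF : IsUpperSet (F : Set P))
    (hp : p ∈ F) (hmin : ∀ q ∈ F, ¬ q < p) : colorWeight c adj b F p = b p := by
  classical
  rw [hb p, colorWeight]
  congr 1
  refine Finset.sum_congr rfl fun q _ => ?_
  by_cases h : q < p
  · rw [if_pos h, if_neg fun h' => hmin q h' h]
  · rw [if_neg h]
    by_cases hq : q ∈ F
    · rw [if_pos hq]
    · rw [if_neg hq, bond_of_not, zero_mul]
      · intro hc
        rcases H.comparable_of_eq q p hc with h' | h'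
        · rcases h'.eq_or_lt with rfl | h'
          exacts [hq hp, h h']
        · exact hq (hF h' hp)
      · intro ha
        rcases H.comparable_of_adj q p ha with h' | h'
        · rcases h'.eq_or_lt with rfl | h'
          exacts [hq hp, h h']
        · exact hq (hF h' hp)

/-- Weights depend only on colours. Erasing `p` turns the weight `b p` of its colour into `-b p` and
adds `b p` to the adjacent colours. Reflected values cancel the sign and leave `b p` times the sum
of the adjacent values minus the sum of all bounds, which `sum_adj_eq` evaluates as the lower bound
at `p`: precisely what the first component subtracts from `σ p`. -/
theorem toggleEquiv_weight {b : P → ℤ} (hb : IsRootHeight c adj b) (hF : IsUpperSet (F : Set P))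
    (hp : p ∈ F) (hmin : ∀ q ∈ F, ¬ q < p) (σ : {σ // IsPartitionOn c adj F σ}) :
    ∑ x ∈ F, colorWeight c adj b F x * σ.1 x = b p * (H.toggleEquiv hF hp hmin σ).1 +
      ∑ x ∈ F.erase p, colorWeight c adj b (F.erase p) x *
        (H.toggleEquiv hF hp hmin σ).2.1 x := by
  classical
  obtain ⟨σ, hσ⟩ := σ
  have hle : lowerBound c adj σ p ≤ σ p := lowerBound_le fun y hy ha =>
    hσ.le p hp y (hF hy.le hp) hy (H.symm ha)
  have hw := H.colorWeight_min hb hF hp hmin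
  set τ := Function.update σ p 0 with hτdef
  have hτ : IsPartitionOn c adj (F.erase p) τ := hσ.update_zero
  have hne : ∀ y, c y ≠ c p → τ y = σ y := fun y hy =>
    Function.update_of_ne (by rintro rfl; exact hy rfl) _ _
  have hlow : lowerBound c adj τ p = lowerBound c adj σ p := H.lowerBound_congr hne
  have hsum := H.sum_adj_eq hF hp hmin hτ p le_rfl rfl
  simp only [toggleEquiv, Equiv.coe_fn_mk]
  rw [← Finset.add_sum_erase F _ hp, hw, ← hlow]
  rw [← hlow] at hle
  push_cast [hle]
  have key : ∀ x ∈ F.erase p, colorWeight c adj b (F.erase p) x *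
        (toggle c adj (F.erase p) (c p) τ x : ℤ) = colorWeight c adj b F x * σ x +
      b p * (((if p < x ∧ adj (c x) (c p) then τ x else 0 : ℕ) : ℤ) -
        ((if p < x ∧ c x = c p then
          lowerBound c adj τ x + upperBound c adj (F.erase p) τ x else 0 : ℕ) : ℤ)) := by
    intro x hx
    have hστ : τ x = σ x := Function.update_of_ne (Finset.ne_of_mem_erase hx) _ _
    rw [colorWeight_erase b hp]
    by_cases h1 : c x = c p
    · have hb' := H.bounds hF hp hmin hτ hx h1
      have hpx := H.lt_of_color_eq hmin hx h1
      have ha : ¬ adj (c x) (c p) := fun h => H.ne_of_adj h h1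
      have hwx : colorWeight c adj b F x = b p := by
        rw [← hw]
        have : ∀ q, bond c adj q x = bond c adj q p := fun q => by unfold bond; rw [h1]
        simp only [colorWeight, this]
      rw [toggle_of_mem hx h1, bond_of_eq adj h1.symm, if_neg fun h => ha h.2, if_pos ⟨hpx, h1⟩,
        hwx, Nat.cast_sub (hb'.2.trans (Nat.le_add_left _ _)), hστ]
      push_cast
      ring
    · rw [toggle_of_ne h1, hστ, if_neg (c := p < x ∧ c x = c p) fun h => h1 h.2]
      by_cases h2 : adj (c x) (c p)
      · have hpx : p < x := by
          rcases H.comparable_of_adj x p h2 with h | h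
          · exact absurd (h.lt_of_ne (Finset.ne_of_mem_erase hx))
              (hmin x (Finset.mem_of_mem_erase hx))
          · exact h.lt_of_ne (Finset.ne_of_mem_erase hx).symm
        rw [if_pos ⟨hpx, h2⟩, H.bond_of_adj (H.symm h2)]
        push_cast
        ring
      · rw [if_neg fun h => h2 h.2, bond_of_not (Ne.symm h1) fun h => h2 (H.symm h)]
        push_cast
        ring
  rw [Finset.sum_congr rfl key, Finset.sum_add_distrib, ← Finset.mul_sum, Finset.sum_sub_distrib,
    ← Nat.cast_sum, ← Nat.cast_sum]
  have hext : ∀ f : P → ℕ, (∀ x ∉ F.erase p, f x = 0) → ∑ x ∈ F.erase p, f x = ∑ x, f x :=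
    fun f hf => Finset.sum_subset (Finset.subset_univ _) fun x _ hx => hf x hx
  have hmem : ∀ x, p < x → x ∈ F.erase p := fun x h => Finset.mem_erase.2 ⟨h.ne', hF h.le hp⟩
  rw [hext _ fun x hx => if_neg fun h => hx (hmem x h.1),
    hext _ fun x hx => if_neg fun h => hx (hmem x h.1), hsum]
  push_cast
  ring

end MinusculeColoring

end Toggle

/-! ### Generating functions and the hook length property. -/

/-- The generating function of the sequences of natural numbers weighted by `h`. -/
theorem mk_card_mul_prod_one_sub_X_pow {P : Type*} [Fintype P] {h : P → ℕ} (hh : ∀ x, 0 < h x) :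
    (PowerSeries.mk fun N => (Nat.card {m : P → ℕ // ∑ x, h x * m x = N} : ℤ)) *
      ∏ x, (1 - (X : ℤ⟦X⟧) ^ h x) = 1 := by
  classical
  have geom : ∀ x, (PowerSeries.mk fun n => if h x ∣ n then (1 : ℤ) else 0) *
      (1 - (X : ℤ⟦X⟧) ^ h x) = 1 := by
    intro x
    ext n
    rw [mul_sub, mul_one, map_sub, coeff_mk, coeff_mul_X_pow', coeff_mk, coeff_one]
    rcases eq_or_ne n 0 with rfl | hn
    · simp [(hh x).ne']
    · by_cases hle : h x ≤ n
      · have : h x ∣ n - h x ↔ h x ∣ n := (Nat.dvd_sub_iff_left hle dvd_rfl)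
        simp only [hle, if_true, this, hn, if_false, sub_self]
      · have : ¬ h x ∣ n := fun hd => hle (Nat.le_of_dvd (Nat.pos_of_ne_zero hn) hd)
        simp [hle, hn, this]
  -- A coefficient of the product counts families of multiples of the `h x` with given sum; dividing
  -- by `h x` recovers `m`.
  have hmk : (PowerSeries.mk fun N => (Nat.card {m : P → ℕ // ∑ x, h x * m x = N} : ℤ)) =
      ∏ x, PowerSeries.mk fun n => if h x ∣ n then (1 : ℤ) else 0 := by
    ext N
    simp only [coeff_mk, coeff_prod, Finset.prod_ite_zero, Finset.prod_const_one,
      Finset.sum_boole, Finset.mem_univ, true_implies]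
    congr 1
    rw [← Fintype.card_coe, ← Nat.card_eq_fintype_card]
    refine Nat.card_congr
      { toFun := fun m => ⟨Finsupp.equivFunOnFinite.symm fun x => h x * m.1 x, ?_⟩
        invFun := fun l => ⟨fun x => l.1 x / h x, ?_⟩
        left_inv := fun m => ?_
        right_inv := fun l => ?_ }
    · simp [Finset.mem_finsuppAntidiag, m.2]
    · have hl := l.2
      simp only [Finset.mem_filter, Finset.mem_finsuppAntidiag] at hl
      simp only [fun x => Nat.mul_div_cancel' (hl.2 x)]
      exact hl.1.1
    · ext x
      simp [Nat.mul_div_cancel_left _ (hh x)]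
    · have hl := l.2
      simp only [Finset.mem_filter, Finset.mem_finsuppAntidiag] at hl
      ext x
      simp [Nat.mul_div_cancel' (hl.2 x)]
  rw [hmk, ← Finset.prod_mul_distrib]
  exact Finset.prod_eq_one fun x _ => geom x

section Coloring

variable {P C : Type*} [PartialOrder P] {c : P → C} {adj : C → C → Prop}

namespace MinusculeColoring

variable (H : MinusculeColoring c adj)
include H

/-- Minimal elements are peeled off one by one, the number recorded for `p` becoming `m p`. -/
theorem exists_equiv_on [Fintype P] [DecidableEq P] {b : P → ℤ} (hb : IsRootHeight c adj b) :
    ∀ n, ∀ F : Finset P, F.card = n → IsUpperSet (F : Set P) →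
      ∃ e : {σ // IsPartitionOn c adj F σ} ≃ {m : P → ℕ // ∀ x ∉ F, m x = 0},
        ∀ σ, ∑ x ∈ F, colorWeight c adj b F x * σ.1 x = ∑ x ∈ F, b x * (e σ).1 x := by
  intro n
  induction n with
  | zero =>
    intro F hF _
    obtain rfl := Finset.card_eq_zero.1 hF
    refine ⟨Equiv.subtypeEquivRight fun σ => ⟨fun h => h.zero, fun h => ⟨by simp, h⟩⟩, by simp⟩
  | succ n ih =>
    intro F hn hF
    have hne : F.Nonempty := Finset.card_pos.1 (by omega)
    obtain ⟨p, hpm⟩ := F.exists_minimal hne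
    have hp := hpm.prop
    have hmin : ∀ q ∈ F, ¬ q < p := fun q hq hlt => hlt.not_ge (hpm.le_of_le hq hlt.le)
    have hF' : IsUpperSet (F.erase p : Set P) := by
      intro x y hxy hx
      rw [Finset.mem_coe, Finset.mem_erase] at hx ⊢
      refine ⟨?_, hF hxy hx.2⟩
      rintro rfl
      exact hmin x hx.2 (hxy.lt_of_ne hx.1)
    obtain ⟨e, he⟩ := ih (F.erase p) (by rw [Finset.card_erase_of_mem hp, hn]; rfl) hF'
    let ins : ℕ × {m : P → ℕ // ∀ x ∉ F.erase p, m x = 0} ≃ {m : P → ℕ // ∀ x ∉ F, m x = 0} :=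
      { toFun := fun t => ⟨Function.update t.2.1 p t.1, fun x hx => by
          have h : x ≠ p := by rintro rfl; exact hx hp
          rw [Function.update_of_ne h]
          exact t.2.2 x fun h' => hx (Finset.mem_of_mem_erase h')⟩
        invFun := fun m => (m.1 p, ⟨Function.update m.1 p 0, fun x hx => by
          rcases eq_or_ne x p with rfl | h
          · simp
          · rw [Function.update_of_ne h]
            exact m.2 x fun h' => hx (Finset.mem_erase.2 ⟨h, h'⟩)⟩)
        left_inv := fun t => by
          obtain ⟨k, m, hm⟩ := t
          have := hm p (Finset.notMem_erase p F)
          simp [Function.update_eq_self_iff, this]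
        right_inv := fun m => by simp }
    refine ⟨((H.toggleEquiv hF hp hmin).trans ((Equiv.refl ℕ).prodCongr e)).trans ins,
      fun σ => ?_⟩
    rw [H.toggleEquiv_weight hb hF hp hmin, he, ← Finset.add_sum_erase F _ hp]
    congr 1
    · simp [ins]
    · refine Finset.sum_congr rfl fun x hx => ?_
      simp [ins, Function.update_of_ne (Finset.ne_of_mem_erase hx)]

/-- Covers join adjacent colours, so conditions along adjacent colours already imply monotonicity.
-/
theorem antitone_iff [Fintype P] {σ : P → ℕ} :
    Antitone σ ↔ IsPartitionOn c adj Finset.univ σ := by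
  constructor
  · intro h
    exact ⟨fun x _ y _ hxy _ => h hxy.le, by simp⟩
  · intro h x y
    induction y using WellFoundedLT.induction with
    | _ y ih =>
      intro hxy
      rcases hxy.eq_or_lt with rfl | hxy
      · exact le_rfl
      · obtain ⟨s, hxs, hs⟩ := exists_le_covBy_of_lt hxy
        exact (h.le s (Finset.mem_univ _) y (Finset.mem_univ _) hs.lt
          (H.adj_of_covBy _ _ hs)).trans (ih s hs.lt hxs)

/-- With nothing removed all weights are `1`, and the weighted sum is the size of the partition. -/
theorem exists_equiv [Fintype P] {b : P → ℤ} (hb : IsRootHeight c adj b) :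
    ∃ e : {σ : P → ℕ // Antitone σ} ≃ (P → ℕ), ∀ σ, ((∑ x, σ.1 x : ℕ) : ℤ) =
      ∑ x, b x * e σ x := by
  classical
  obtain ⟨e, he⟩ := H.exists_equiv_on hb _ Finset.univ rfl (by simp [isUpperSet_univ])
  refine ⟨((Equiv.subtypeEquivRight fun σ => H.antitone_iff).trans e).trans
    (Equiv.subtypeUnivEquiv (by simp)), fun σ => ?_⟩
  have := he ⟨σ.1, H.antitone_iff.1 σ.2⟩
  simp only [colorWeight, Finset.mem_univ, if_true, Finset.sum_const_zero, add_zero,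
    one_mul] at this
  rw [Nat.cast_sum, this]
  rfl

/-- Positivity is read off the bijection: the indicator of `p` corresponds to a partition of size `b
p`, so `b p ≥ 0`, and size `0` would make it correspond to the zero partition, as `m = 0` already
does. -/
theorem rootHeight_pos [Fintype P] {b : P → ℤ} (hb : IsRootHeight c adj b) (p : P) : 0 < b p := by
  classical
  obtain ⟨e, he⟩ := H.exists_equiv hb
  have h1 : ∀ m : P → ℕ, 0 ≤ ∑ x, b x * (m x : ℤ) := fun m => by
    have := he (e.symm m)
    rw [e.apply_symm_apply] at this
    rw [← this]
    positivity
  have h2 : ∀ m : P → ℕ, ∑ x, b x * (m x : ℤ) = 0 → (e.symm m).1 = 0 := fun m hm => by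
    have := he (e.symm m)
    rw [e.apply_symm_apply, hm] at this
    have h3 : ∑ x, (e.symm m).1 x = 0 := by exact_mod_cast this
    funext x
    exact Finset.sum_eq_zero_iff.1 h3 x (Finset.mem_univ x)
  have h3 : ∑ x, b x * ((Pi.single p 1 : P → ℕ) x : ℤ) = b p := by
    rw [Finset.sum_eq_single p] <;> simp +contextual
  refine lt_of_le_of_ne (h3 ▸ h1 _) fun h => ?_
  have h4 := h2 _ (h3.trans h.symm)
  have h5 := h2 0 (by simp)
  have h6 : (Pi.single p 1 : P → ℕ) = 0 := e.symm.injective (Subtype.ext (h4.trans h5.symm))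
  simpa using congrFun h6 p

theorem hookLengthProperty [Fintype P] : HookLengthProperty P := by
  obtain ⟨b, hb⟩ := exists_isRootHeight c adj
  obtain ⟨e, he⟩ := H.exists_equiv hb
  have hpos := H.rootHeight_pos hb
  have hh : ∀ p, ((b p).toNat : ℤ) = b p := fun p => Int.toNat_of_nonneg (hpos p).le
  have hH := H.isHookLength hb hh
  refine ⟨fun p => (b p).toNat, hH, fun h' h => H.hookLength_unique hH h, ?_⟩
  have hpos' : ∀ x, 0 < (b x).toNat := fun x => by
    have := hpos x
    omega
  refine Eq.trans ?_ (mk_card_mul_prod_one_sub_X_pow hpos')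
  rw [partitionGF]
  congr 2
  funext N
  congr 1
  have h1 : ∀ σ : {σ : P → ℕ // Antitone σ},
      ∑ x, σ.1 x = N ↔ ∑ x, (b x).toNat * e σ x = N := by
    intro σ
    have h2 : ((∑ x, (b x).toNat * e σ x : ℕ) : ℤ) = ((∑ x, σ.1 x : ℕ) : ℤ) := by
      rw [he σ]
      push_cast
      simp only [hh]
    rw [Nat.cast_inj] at h2
    rw [h2]
  exact Nat.card_congr ((Equiv.subtypeSubtypeEquivSubtypeInter _ _).symm.trans
    (e.subtypeEquiv h1))

end MinusculeColoring

end Coloring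

/-! ### The swivel in coordinates (colour, rank). -/

section SwivelModel

/-- Adjacency in the tree with a path `some t` (`t : ℤ`) and a leaf `none` attached to `some 0`. -/
def TreeAdj : Option ℤ → Option ℤ → Prop
  | some s, some t => s = t + 1 ∨ t = s + 1
  | some s, none => s = 0
  | none, some t => t = 0
  | none, none => False

/-- The distance of the colours `i` and `j` in the tree is at most `d`. -/
def TreeDistLE : Option ℤ → Option ℤ → ℤ → Prop
  | some s, some t, d => s - t ≤ d ∧ t - s ≤ d
  | some s, none, d => s + 1 ≤ d ∧ 1 - s ≤ d
  | none, some t, d => t + 1 ≤ d ∧ 1 - t ≤ d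
  | none, none, d => 0 ≤ d

/-- The pairs `(colour, rank)` of the elements of the swivel. -/
def SwivelCell (l : Fin 5 → ℕ) : Option ℤ → ℤ → Prop
  | none, r => r = -1 ∨ r = -5
  | some t, r =>
    (t = -2 ∧ (r = -2 ∨ r = -8)) ∨ (t = -1 ∧ (r = -1 ∨ r = -3 ∨ r = -7 ∨ r = -9)) ∨
    (t = 0 ∧ (r = 0 ∨ r = -2 ∨ r = -4 ∨ r = -6 ∨ r = -8 ∨ r = -10)) ∨
    -- The case `r = t` is the chain attached on top; the other five are the rows of the shifted
    -- diagram of `λ`.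
    (1 ≤ t ∧ ((r = t ∧ t ≤ l 0 + 4) ∨ (r = -t - 2 ∧ t ≤ l 0 + 4) ∨ (r = -t - 4 ∧ t ≤ l 1 + 3) ∨
      (r = -t - 6 ∧ t ≤ l 2 + 2) ∨ (r = -t - 8 ∧ t ≤ l 3 + 1) ∨ (r = -t - 10 ∧ t ≤ l 4)))

/-- `P` is the set of pairs `(colour, rank)` in `SwivelCell l`, ordered by the light cones. -/
structure IsSwivelModel {P : Type*} [PartialOrder P] (l : Fin 5 → ℕ) (col : P → Option ℤ)
    (rk : P → ℤ) : Prop where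
  le_iff : ∀ x y, x ≤ y ↔ TreeDistLE (col x) (col y) (rk y - rk x)
  mem : ∀ x, SwivelCell l (col x) (rk x)
  exists_mem : ∀ i r, SwivelCell l i r → ∃ x, col x = i ∧ rk x = r

variable {l : Fin 5 → ℕ}

theorem SwivelCell.arm {t r : ℤ} (ht : 1 ≤ t) (h : (r = t ∧ t ≤ l 0 + 4) ∨
    (r = -t - 2 ∧ t ≤ l 0 + 4) ∨ (r = -t - 4 ∧ t ≤ l 1 + 3) ∨ (r = -t - 6 ∧ t ≤ l 2 + 2) ∨
    (r = -t - 8 ∧ t ≤ l 3 + 1) ∨ (r = -t - 10 ∧ t ≤ l 4)) : SwivelCell l (some t) r :=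
  Or.inr (Or.inr (Or.inr ⟨ht, h⟩))

theorem treeAdj_symm {i j : Option ℤ} (h : TreeAdj i j) : TreeAdj j i := by
  rcases i with _ | i <;> rcases j with _ | j <;> simp only [TreeAdj] at * <;> omega

theorem treeAdj_ne {i j : Option ℤ} (h : TreeAdj i j) : i ≠ j := by
  rintro rfl
  rcases i with _ | i <;> simp only [TreeAdj] at * 
  omega

theorem treeAdj_no_square (i j k m : Option ℤ) (h1 : TreeAdj i k) (h2 : TreeAdj i m)
    (h3 : TreeAdj j k) (h4 : TreeAdj j m) : i = j ∨ k = m := by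
  rcases i with _ | i <;> rcases j with _ | j <;> rcases k with _ | k <;> rcases m with _ | m <;>
    simp only [TreeAdj, Option.some.injEq, reduceCtorEq, or_true, true_or, or_false,
      false_or] at * <;> omega

theorem treeAdj_degree_two (i : Option ℤ) (hi : i ≠ some 0) (j k m : Option ℤ) (h1 : TreeAdj i j)
    (h2 : TreeAdj i k) (h3 : TreeAdj i m) : j = k ∨ j = m ∨ k = m := by
  rcases i with _ | i <;> rcases j with _ | j <;> rcases k with _ | k <;> rcases m with _ | m <;>
    simp only [TreeAdj, Option.some.injEq, reduceCtorEq, or_true, or_false,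
      false_or, ne_eq] at * <;> omega

theorem treeAdj_degree_three (j k m n : Option ℤ) (h1 : TreeAdj (some 0) j)
    (h2 : TreeAdj (some 0) k) (h3 : TreeAdj (some 0) m) (h4 : TreeAdj (some 0) n) :
    j = k ∨ j = m ∨ j = n ∨ k = m ∨ k = n ∨ m = n := by
  rcases j with _ | j <;> rcases k with _ | k <;> rcases m with _ | m <;> rcases n with _ | n <;>
    simp only [TreeAdj, Option.some.injEq, reduceCtorEq, or_true, true_or, or_false,
      false_or] at * <;> omega

theorem treeDistLE_one {i j : Option ℤ} (h : TreeAdj i j) {d : ℤ} (hd : 1 ≤ d) :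
    TreeDistLE i j d := by
  rcases i with _ | i <;> rcases j with _ | j <;> simp only [TreeAdj, TreeDistLE] at * <;> omega

theorem treeDistLE_self (i : Option ℤ) {d : ℤ} (hd : 0 ≤ d) : TreeDistLE i i d := by
  rcases i with _ | i <;> simp only [TreeDistLE] <;> omega

theorem TreeDistLE.nonneg {i j : Option ℤ} {d : ℤ} (h : TreeDistLE i j d) : 0 ≤ d := by
  rcases i with _ | i <;> rcases j with _ | j <;> simp only [TreeDistLE] at * <;> omega

theorem TreeDistLE.eq_of_zero {i j : Option ℤ} (h : TreeDistLE i j 0) : i = j := by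
  rcases i with _ | i <;> rcases j with _ | j <;>
    simp only [TreeDistLE, Option.some.injEq, reduceCtorEq] at * <;> omega

theorem SwivelCell.even_sub {t r : ℤ} (h : SwivelCell l (some t) r) : (r - t) % 2 = 0 := by
  simp only [SwivelCell] at h
  omega

theorem SwivelCell.ne_of_adj {i j : Option ℤ} {r s : ℤ} (hi : SwivelCell l i r)
    (hj : SwivelCell l j s) (h : TreeAdj i j) : r ≠ s := by
  rcases i with _ | i <;> rcases j with _ | j
  · exact h.elim
  · have := hj.even_sub
    simp only [SwivelCell, TreeAdj] at hi h
    omega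
  · have := hi.even_sub
    simp only [SwivelCell, TreeAdj] at hj h
    omega
  · have := hi.even_sub
    have := hj.even_sub
    simp only [TreeAdj] at h
    omega

/-- By parity the rank difference minus the tree distance is even, so positive slack is at least
two. -/
theorem SwivelCell.treeDistLE_sub_two {i j : Option ℤ} {r s : ℤ} (hi : SwivelCell l i r)
    (hj : SwivelCell l j s) (h : TreeDistLE i j (s - r - 1)) : TreeDistLE i j (s - r - 2) := by
  rcases i with _ | i <;> rcases j with _ | j
  · simp only [SwivelCell, TreeDistLE] at *
    omega
  · have := hj.even_sub
    simp only [SwivelCell, TreeDistLE] at hi h ⊢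
    omega
  · have := hi.even_sub
    simp only [SwivelCell, TreeDistLE] at hj h ⊢
    omega
  · have := hi.even_sub
    have := hj.even_sub
    simp only [TreeDistLE] at h ⊢
    omega

theorem SwivelCell.left {t r : ℤ} (ht : 1 ≤ t) (h : (r = -t - 2 ∧ t ≤ l 0 + 4) ∨
    (r = -t - 4 ∧ t ≤ l 1 + 3) ∨ (r = -t - 6 ∧ t ≤ l 2 + 2) ∨ (r = -t - 8 ∧ t ≤ l 3 + 1) ∨
    (r = -t - 10 ∧ t ≤ l 4)) : SwivelCell l (some (t - 1)) (r + 1) := by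
  rcases ht.eq_or_lt with rfl | ht
  · simp only [SwivelCell]
    omega
  · exact SwivelCell.arm (by omega) (by omega)

/-- The cell above and to the right lies in the preceding row, which is long enough because `λ` is
decreasing. -/
theorem SwivelCell.right (hl : Antitone l) {t r : ℤ} (ht : 1 ≤ t)
    (h : (r = -t - 4 ∧ t ≤ l 1 + 3) ∨ (r = -t - 6 ∧ t ≤ l 2 + 2) ∨ (r = -t - 8 ∧ t ≤ l 3 + 1) ∨
      (r = -t - 10 ∧ t ≤ l 4)) : SwivelCell l (some (t + 1)) (r + 1) := by
  have h01 : l 1 ≤ l 0 := hl (by decide)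
  have h12 : l 2 ≤ l 1 := hl (by decide)
  have h23 : l 3 ≤ l 2 := hl (by decide)
  have h34 : l 4 ≤ l 3 := hl (by decide)
  exact SwivelCell.arm (by omega) (by omega)

set_option linter.unusedSimpArgs false in
/-- Above every cell `(i, r)` there is, towards any larger cell, a cell of an adjacent colour. -/
theorem SwivelCell.exists_between (hl : Antitone l) {i j : Option ℤ} {r s : ℤ}
    (hi : SwivelCell l i r) (hj : SwivelCell l j s) (h : TreeDistLE i j (s - r)) (hrs : r < s) :
    i = j ∨ ∃ k, SwivelCell l k (r + 1) ∧ TreeAdj i k ∧ TreeDistLE k j (s - (r + 1)) := by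
  have h01 : l 1 ≤ l 0 := hl (by decide)
  have h12 : l 2 ≤ l 1 := hl (by decide)
  have h23 : l 3 ≤ l 2 := hl (by decide)
  have h34 : l 4 ≤ l 3 := hl (by decide)
  rcases eq_or_ne i j with hij | hij
  · exact Or.inl hij
  refine Or.inr ?_
  rcases i with _ | i
  · rcases j with _ | j
    · exact absurd rfl hij
    · refine ⟨some 0, ?_⟩
      simp only [SwivelCell, TreeAdj, TreeDistLE, true_and] at *
      omega
  rcases j with _ | j
  · clear hij
    -- One case per family of cells. The witness is the next colour towards the leaf when it has a
    -- cell at rank `r + 1`; otherwise another neighbour is used, as at `(some 0, -4)`, and the even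
    -- slack pays for the detour.
    rcases hi with ⟨rfl, rfl | rfl⟩ | ⟨rfl, rfl | rfl | rfl | rfl⟩ |
      ⟨rfl, rfl | rfl | rfl | rfl | rfl | rfl⟩ |
      ⟨hi, ⟨rfl, h'⟩ | ⟨rfl, h'⟩ | ⟨rfl, h'⟩ | ⟨rfl, h'⟩ | ⟨rfl, h'⟩ | ⟨rfl, h'⟩⟩
    · refine ⟨some (-1), ?_⟩
      simp only [SwivelCell, TreeAdj, TreeDistLE, true_and] at *
      omega
    · refine ⟨some (-1), ?_⟩
      simp only [SwivelCell, TreeAdj, TreeDistLE, true_and] at *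
      omega
    · refine ⟨some 0, ?_⟩
      simp only [SwivelCell, TreeAdj, TreeDistLE, true_and] at *
      omega
    · refine ⟨some 0, ?_⟩
      simp only [SwivelCell, TreeAdj, TreeDistLE, true_and] at *
      omega
    · refine ⟨some 0, ?_⟩
      simp only [SwivelCell, TreeAdj, TreeDistLE, true_and] at *
      omega
    · refine ⟨some 0, ?_⟩
      simp only [SwivelCell, TreeAdj, TreeDistLE, true_and] at *
      omega
    · refine ⟨some 1, ?_⟩
      simp only [SwivelCell, TreeAdj, TreeDistLE, true_and] at *
      omega
    · refine ⟨none, ?_⟩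
      simp only [SwivelCell, TreeAdj, TreeDistLE, true_and] at *
      omega
    · refine ⟨some (-1), ?_⟩
      simp only [SwivelCell, TreeAdj, TreeDistLE, true_and] at *
      omega
    · refine ⟨none, ?_⟩
      simp only [SwivelCell, TreeAdj, TreeDistLE, true_and] at *
      omega
    · refine ⟨some (-1), ?_⟩
      simp only [SwivelCell, TreeAdj, TreeDistLE, true_and] at *
      omega
    · refine ⟨some (-1), ?_⟩
      simp only [SwivelCell, TreeAdj, TreeDistLE, true_and] at *
      omega
    · refine ⟨some (r + 1), ?_⟩
      simp only [SwivelCell, TreeAdj, TreeDistLE, true_and] at *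
      omega
    · refine ⟨some (i - 1), ?_⟩
      simp only [SwivelCell, TreeAdj, TreeDistLE, true_and] at *
      omega
    · refine ⟨some (i - 1), ?_⟩
      simp only [SwivelCell, TreeAdj, TreeDistLE, true_and] at *
      omega
    · refine ⟨some (i - 1), ?_⟩
      simp only [SwivelCell, TreeAdj, TreeDistLE, true_and] at *
      omega
    · refine ⟨some (i - 1), ?_⟩
      simp only [SwivelCell, TreeAdj, TreeDistLE, true_and] at *
      omega
    · refine ⟨some (i - 1), ?_⟩
      simp only [SwivelCell, TreeAdj, TreeDistLE, true_and] at *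
      omega
  · have hij : i ≠ j := fun h => hij (h ▸ rfl)
    rcases hi with ⟨rfl, rfl | rfl⟩ | ⟨rfl, rfl | rfl | rfl | rfl⟩ |
      ⟨rfl, rfl | rfl | rfl | rfl | rfl | rfl⟩ |
      ⟨hi, ⟨rfl, h'⟩ | ⟨rfl, h'⟩ | ⟨rfl, h'⟩ | ⟨rfl, h'⟩ | ⟨rfl, h'⟩ | ⟨rfl, h'⟩⟩
    · refine ⟨some (-1), ?_⟩
      simp only [SwivelCell, TreeAdj, TreeDistLE, true_and] at *
      omega
    · refine ⟨some (-1), ?_⟩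
      simp only [SwivelCell, TreeAdj, TreeDistLE, true_and] at *
      omega
    · refine ⟨some 0, ?_⟩
      simp only [SwivelCell, TreeAdj, TreeDistLE, true_and] at *
      omega
    · by_cases hc : j = -2
      · refine ⟨some (-2), ?_⟩
        simp only [SwivelCell, TreeAdj, TreeDistLE, true_and] at *
        omega
      · refine ⟨some 0, ?_⟩
        simp only [SwivelCell, TreeAdj, TreeDistLE, true_and] at *
        omega
    · refine ⟨some 0, ?_⟩
      simp only [SwivelCell, TreeAdj, TreeDistLE, true_and] at *
      omega
    · by_cases hc : j = -2
      · refine ⟨some (-2), ?_⟩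
        simp only [SwivelCell, TreeAdj, TreeDistLE, true_and] at *
        omega
      · refine ⟨some 0, ?_⟩
        simp only [SwivelCell, TreeAdj, TreeDistLE, true_and] at *
        omega
    · refine ⟨some 1, ?_⟩
      simp only [SwivelCell, TreeAdj, TreeDistLE, true_and] at *
      omega
    · refine ⟨some (-1), ?_⟩
      simp only [SwivelCell, TreeAdj, TreeDistLE, true_and] at *
      omega
    · by_cases hc : j < 0
      · refine ⟨some (-1), ?_⟩
        simp only [SwivelCell, TreeAdj, TreeDistLE, true_and] at *
        omega
      · refine ⟨some 1, ?_⟩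
        simp only [SwivelCell, TreeAdj, TreeDistLE, true_and] at *
        omega
    · refine ⟨some 1, ?_⟩
      simp only [SwivelCell, TreeAdj, TreeDistLE, true_and] at *
      omega
    · by_cases hc : j < 0
      · refine ⟨some (-1), ?_⟩
        simp only [SwivelCell, TreeAdj, TreeDistLE, true_and] at *
        omega
      · refine ⟨some 1, ?_⟩
        simp only [SwivelCell, TreeAdj, TreeDistLE, true_and] at *
        omega
    · by_cases hc : j < 0
      · refine ⟨some (-1), ?_⟩
        simp only [SwivelCell, TreeAdj, TreeDistLE, true_and] at *
        omega
      · refine ⟨some 1, ?_⟩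
        simp only [SwivelCell, TreeAdj, TreeDistLE, true_and] at *
        omega
    -- Above a cell of the attached chain there are only cells of that chain.
    · have hs : s = j ∧ j ≤ l 0 + 4 ∧ r < j := by
        simp only [SwivelCell, TreeDistLE] at hj h
        omega
      refine ⟨some (r + 1), SwivelCell.arm (by omega) (Or.inl ⟨rfl, by omega⟩), Or.inr rfl, ?_⟩
      simp only [TreeDistLE]
      omega
    -- The first row has no cell of colour `i + 1` just above, so even larger colours, reached only
    -- on the attached chain, are approached from the left.
    · refine ⟨some (i - 1), SwivelCell.left hi (Or.inl ⟨rfl, h'⟩), Or.inl (by omega), ?_⟩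
      simp only [SwivelCell] at hj
      simp only [TreeDistLE] at h ⊢
      omega
    all_goals
      simp only [TreeDistLE] at h
      rcases lt_or_gt_of_ne hij with hc | hc
      · refine ⟨some (i + 1), SwivelCell.right hl hi (by omega), Or.inr rfl, ?_⟩
        simp only [TreeDistLE]
        omega
      · refine ⟨some (i - 1), SwivelCell.left hi (by omega), Or.inl (by omega), ?_⟩
        simp only [TreeDistLE]
        omega

/-- Two adjacent cells above the topmost cell of a colour coincide. -/
theorem SwivelCell.eq_of_top (hl : Antitone l) {i j k : Option ℤ} {r s t : ℤ}
    (hi : SwivelCell l i r) (htop : ∀ r', SwivelCell l i r' → r' ≤ r) (hj : SwivelCell l j s)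
    (hk : SwivelCell l k t) (hij : TreeAdj j i) (hik : TreeAdj k i) (hs : r < s) (ht : r < t) :
    j = k ∧ s = t := by
  have h01 : l 1 ≤ l 0 := hl (by decide)
  have h12 : l 2 ≤ l 1 := hl (by decide)
  have h23 : l 3 ≤ l 2 := hl (by decide)
  have h34 : l 4 ≤ l 3 := hl (by decide)
  have key : ∃ m, ∀ j s, SwivelCell l j s → TreeAdj j i → r < s → j = m ∧ s = r + 1 := by
    rcases i with _ | i
    · have := htop (-1) (Or.inl rfl)
      refine ⟨some 0, fun j s hj hij hs => ?_⟩
      rcases j with _ | j <;> simp only [SwivelCell, TreeAdj, Option.some.injEq] at hi hj hij ⊢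
      omega
    · simp only [SwivelCell] at hi
      -- The topmost cell of each path colour `i` has rank `i`: on the long arm the attached chain
      -- uses the same colours as the first row. Its only neighbour above is `(i + 1, i + 1)`.
      have hr : r = i := by
        rcases hi with ⟨rfl, hi⟩ | ⟨rfl, hi⟩ | ⟨rfl, hi⟩ | ⟨hi, hi'⟩
        · have := htop (-2) (by simp [SwivelCell])
          omega
        · have := htop (-1) (by simp [SwivelCell])
          omega
        · have := htop 0 (by simp [SwivelCell])
          omega
        · have := htop i (SwivelCell.arm hi (Or.inl ⟨rfl, by omega⟩))
          omega
      subst hr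
      clear htop
      refine ⟨some (r + 1), fun j s hj hij hs => ?_⟩
      rcases j with _ | j
      · simp only [SwivelCell, TreeAdj] at hj hij
        omega
      · simp only [TreeAdj] at hij
        simp only [SwivelCell] at hj
        rw [Option.some.injEq]
        rcases hij with rfl | rfl
        · omega
        · omega
  obtain ⟨m, hm⟩ := key
  obtain ⟨rfl, rfl⟩ := hm j s hj hij hs
  obtain ⟨rfl, rfl⟩ := hm k t hk hik ht
  exact ⟨rfl, rfl⟩

/-- A bottommost cell `(j, s)` of its colour is not two steps away from the shortest path to a
smaller cell, unless there is a cell of the colour of the latter in between. -/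
theorem SwivelCell.exists_of_slack (hl : Antitone l) {i j : Option ℤ} {r s : ℤ}
    (hi : SwivelCell l i r) (hj : SwivelCell l j s) (hbot : ∀ s', SwivelCell l j s' → s ≤ s')
    (hij : i ≠ j) (h : TreeDistLE i j (s - r - 2)) : SwivelCell l i (r + 2) := by
  have h01 : l 1 ≤ l 0 := hl (by decide)
  have h12 : l 2 ≤ l 1 := hl (by decide)
  have h23 : l 3 ≤ l 2 := hl (by decide)
  have h34 : l 4 ≤ l 3 := hl (by decide)
  rcases j with _ | j
  · have := hbot (-5) (Or.inr rfl)
    obtain rfl : s = -5 := by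
      simp only [SwivelCell] at hj
      omega
    clear hj hbot
    rcases i with _ | i
    · exact absurd rfl hij
    · simp only [SwivelCell, TreeDistLE] at hi h ⊢
      rcases hi with ⟨rfl, rfl | rfl⟩ | ⟨rfl, rfl | rfl | rfl | rfl⟩ |
        ⟨rfl, rfl | rfl | rfl | rfl | rfl | rfl⟩ |
        ⟨hi, ⟨rfl, h'⟩ | ⟨rfl, h'⟩ | ⟨rfl, h'⟩ | ⟨rfl, h'⟩ | ⟨rfl, h'⟩ | ⟨rfl, h'⟩⟩ <;>
        omega
  -- For a path colour `j` such slack never occurs; only the leaf, whose lowest cell is at rank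
  -- `-5`, admits it.
  · exfalso
    have hj' : (j = -2 ∧ s = -8) ∨ (j = -1 ∧ s = -9) ∨ (j = 0 ∧ s = -10) ∨ (1 ≤ j ∧
        ((s = -j - 2 ∧ l 1 + 3 < j) ∨ (s = -j - 4 ∧ l 2 + 2 < j) ∨
          (s = -j - 6 ∧ l 3 + 1 < j) ∨ (s = -j - 8 ∧ l 4 < j) ∨ (s = -j - 10))) := by
      simp only [SwivelCell] at hj
      rcases hj with ⟨rfl, hj⟩ | ⟨rfl, hj⟩ | ⟨rfl, hj⟩ | ⟨hj, hj'⟩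
      · have := hbot (-8) (by simp [SwivelCell])
        omega
      · have := hbot (-9) (by simp [SwivelCell])
        omega
      · have := hbot (-10) (by simp [SwivelCell])
        omega
      · rcases hj' with ⟨rfl, h2⟩ | ⟨rfl, h2⟩ | ⟨rfl, h2⟩ | ⟨rfl, h2⟩ | ⟨rfl, h2⟩ | ⟨rfl, h2⟩
        · by_contra hcon
          have := hbot (-s - 2) (SwivelCell.arm hj (Or.inr (Or.inl ⟨rfl, by omega⟩)))
          omega
        · by_contra hcon
          have := hbot (-j - 4) (SwivelCell.arm hj (Or.inr (Or.inr (Or.inl ⟨rfl, by omega⟩))))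
          omega
        · by_contra hcon
          have := hbot (-j - 6) (SwivelCell.arm hj (Or.inr (Or.inr (Or.inr (Or.inl ⟨rfl, by omega⟩)))))
          omega
        · by_contra hcon
          have := hbot (-j - 8) (SwivelCell.arm hj (Or.inr (Or.inr (Or.inr (Or.inr (Or.inl ⟨rfl, by omega⟩))))))
          omega
        · by_contra hcon
          have := hbot (-j - 10) (SwivelCell.arm hj (Or.inr (Or.inr (Or.inr (Or.inr (Or.inr ⟨rfl, by omega⟩))))))
          omega
        · omega
    rcases i with _ | i
    · simp only [SwivelCell, TreeDistLE] at hi h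
      omega
    · replace hij : i ≠ j := fun h => hij (h ▸ rfl)
      simp only [SwivelCell, TreeDistLE] at hi h
      rcases hi with ⟨rfl, rfl | rfl⟩ | ⟨rfl, rfl | rfl | rfl | rfl⟩ |
        ⟨rfl, rfl | rfl | rfl | rfl | rfl | rfl⟩ |
        ⟨hi, ⟨rfl, h'⟩ | ⟨rfl, h'⟩ | ⟨rfl, h'⟩ | ⟨rfl, h'⟩ | ⟨rfl, h'⟩ | ⟨rfl, h'⟩⟩ <;>
        rcases hj' with ⟨rfl, rfl⟩ | ⟨rfl, rfl⟩ | ⟨rfl, rfl⟩ | ⟨hj, ⟨rfl, h2⟩ | ⟨rfl, h2⟩ | ⟨rfl, h2⟩ |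
          ⟨rfl, h2⟩ | rfl⟩ <;> omega

/-- On a shortest path, the next colour is determined. -/
theorem eq_of_tight {i j k m : Option ℤ} {d s t : ℤ} (h : ¬ TreeDistLE i j (d - 1))
    (hk : TreeAdj k i) (hm : TreeAdj m i) (hs : 0 < s) (ht : 0 < t) (hkj : TreeDistLE k j (d - s))
    (hmj : TreeDistLE m j (d - t)) : k = m ∧ s = t := by
  rcases i with _ | i <;> rcases j with _ | j <;> rcases k with _ | k <;> rcases m with _ | m <;>
    simp only [TreeAdj, TreeDistLE, Option.some.injEq, reduceCtorEq, true_and] at * <;> omega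

end SwivelModel

/-! ### Links between consecutive cells of one colour. -/

section SwivelModel

variable {l : Fin 5 → ℕ}

/-- The cell below `(i, r)` of the same colour has rank `p`, and the cells of adjacent colours
between them are `(j, s)` and `(k, t)`. -/
structure SwivelLink (l : Fin 5 → ℕ) (i : Option ℤ) (r p : ℤ) (j : Option ℤ) (s : ℤ)
    (k : Option ℤ) (t : ℤ) : Prop where
  mem : SwivelCell l i p
  lt : p < r
  max : ∀ q, SwivelCell l i q → q < r → q ≤ p
  mem_left : SwivelCell l j s
  mem_right : SwivelCell l k t
  adj_left : TreeAdj j i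
  adj_right : TreeAdj k i
  left : p < s ∧ s < r
  right : p < t ∧ t < r
  ne : j ≠ k ∨ s ≠ t
  eq_or_eq : ∀ m q, SwivelCell l m q → TreeAdj m i → p < q → q < r →
    (m = j ∧ q = s) ∨ (m = k ∧ q = t)
  color : j = k ∨ (¬ TreeDistLE j k (t - s) ∧ ¬ TreeDistLE k j (s - t))

/-- Two consecutive rows meet in a unit square, whose other two corners are the link. -/
theorem SwivelLink.of_arm {i r : ℤ} (hi : 1 ≤ i) (h1 : SwivelCell l (some i) (r - 2))
    (h2 : SwivelCell l (some (i - 1)) (r - 1)) (h3 : SwivelCell l (some (i + 1)) (r - 1))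
    (h4 : ¬ SwivelCell l (some i) (r - 1)) :
    SwivelLink l (some i) r (r - 2) (some (i - 1)) (r - 1) (some (i + 1)) (r - 1) where
  mem := h1
  lt := by omega
  max q hq hqr := by
    by_contra hcon
    exact h4 ((by omega : q = r - 1) ▸ hq)
  mem_left := h2
  mem_right := h3
  adj_left := by simp [TreeAdj]
  adj_right := by simp [TreeAdj]
  left := by omega
  right := by omega
  ne := Or.inl (by rw [ne_eq, Option.some.injEq]; omega)
  eq_or_eq m q _ ha h1 h2 := by
    rcases m with _ | m
    · simp only [TreeAdj] at ha
      omega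
    · simp only [TreeAdj, Option.some.injEq] at ha ⊢
      omega
  color := Or.inr (by simp only [TreeDistLE]; omega)

/-- Between the chain element of colour `i` and the first-row cell of that colour, the link consists
of the two cells of colour `i - 1` on the chain and in the first row, or on the diagonal if `i = 1`;
these links produce the long tails. -/
theorem SwivelLink.of_top {i : ℤ} (hi : 1 ≤ i) (h : i ≤ l 0 + 4) :
    SwivelLink l (some i) i (-i - 2) (some (i - 1)) (-i - 1) (some (i - 1)) (i - 1) where
  mem := SwivelCell.arm hi (by omega)
  lt := by omega
  max q hq hqr := by
    simp only [SwivelCell] at hq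
    omega
  mem_left := by
    have := SwivelCell.left (l := l) hi (Or.inl ⟨rfl, h⟩)
    rwa [show -i - 2 + 1 = -i - 1 by ring] at this
  mem_right := by
    rcases hi.eq_or_lt with rfl | hi
    · simp [SwivelCell]
    · exact SwivelCell.arm (by omega) (by omega)
  adj_left := by simp [TreeAdj]
  adj_right := by simp [TreeAdj]
  left := by omega
  right := by omega
  ne := Or.inr (by omega)
  eq_or_eq m q hm ha h1 h2 := by
    rcases m with _ | m
    · simp only [TreeAdj] at ha
      omega
    · simp only [TreeAdj, Option.some.injEq] at ha ⊢
      simp only [SwivelCell] at hm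
      rcases ha with rfl | rfl <;> omega
  color := Or.inl rfl

set_option linter.unusedSimpArgs false in
-- Between consecutive diagonal cells exactly two of the three branches contribute. From the top the
-- missing one is the long arm, the leaf, the short path, the leaf, the leaf; the pieces of the
-- swivel are arranged to achieve this.
theorem SwivelCell.exists_link (hl : Antitone l) {i : Option ℤ} {r r' : ℤ} (hi : SwivelCell l i r)
    (hi' : SwivelCell l i r') (hr : r' < r) : ∃ p j s k t, SwivelLink l i r p j s k t := by
  have h01 : l 1 ≤ l 0 := hl (by decide)
  have h12 : l 2 ≤ l 1 := hl (by decide)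
  have h23 : l 3 ≤ l 2 := hl (by decide)
  have h34 : l 4 ≤ l 3 := hl (by decide)
  have fin : ∀ {i r} p j s k t, (SwivelCell l i p ∧ p < r ∧ SwivelCell l j s ∧ SwivelCell l k t ∧
      TreeAdj j i ∧ TreeAdj k i ∧ (p < s ∧ s < r) ∧ (p < t ∧ t < r) ∧ (j ≠ k ∨ s ≠ t) ∧
      (j = k ∨ (¬ TreeDistLE j k (t - s) ∧ ¬ TreeDistLE k j (s - t)))) →
      (∀ q, SwivelCell l i q → q < r → q ≤ p) →
      (∀ m q, SwivelCell l m q → TreeAdj m i → p < q → q < r →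
        (m = j ∧ q = s) ∨ (m = k ∧ q = t)) → ∃ p j s k t, SwivelLink l i r p j s k t :=
    fun p j s k t ⟨h1, h2, h3, h4, h5, h6, h7, h8, h9, h10⟩ h11 h12 =>
      ⟨p, j, s, k, t, h1, h2, h11, h3, h4, h5, h6, h7, h8, h9, h12, h10⟩
  rcases i with _ | i
  · obtain rfl : r = -1 := by
      simp only [SwivelCell] at hi hi'
      omega
    refine fin (-5) (some 0) (-2) (some 0) (-4) (by simp [SwivelCell, TreeAdj, TreeDistLE])
      (fun q hq hqr => ?_) fun m q hm ha h1 h2 => ?_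
    · simp only [SwivelCell] at hq
      omega
    · rcases m with _ | m <;>
        simp only [SwivelCell, TreeAdj, Option.some.injEq, reduceCtorEq, false_and, or_false,
            false_or, true_and] at hm ha ⊢; omega
  · rcases hi with ⟨rfl, rfl | rfl⟩ | ⟨rfl, rfl | rfl | rfl | rfl⟩ |
      ⟨rfl, rfl | rfl | rfl | rfl | rfl | rfl⟩ |
      ⟨hi, ⟨rfl, h'⟩ | ⟨rfl, h'⟩ | ⟨rfl, h'⟩ | ⟨rfl, h'⟩ | ⟨rfl, h'⟩ | ⟨rfl, h'⟩⟩
    · refine fin (-8) (some (-1)) (-3) (some (-1)) (-7) (by simp [SwivelCell, TreeAdj, TreeDistLE])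
        (fun q hq hqr => ?_) fun m q hm ha h1 h2 => ?_
      · simp only [SwivelCell] at hq
        omega
      · rcases m with _ | m <;>
          simp only [SwivelCell, TreeAdj, Option.some.injEq, reduceCtorEq, false_and, or_false,
            false_or, true_and] at hm ha ⊢; omega
    · simp only [SwivelCell] at hi'
      omega
    · refine fin (-3) (some 0) (-2) (some (-2)) (-2) (by simp [SwivelCell, TreeAdj, TreeDistLE])
        (fun q hq hqr => ?_) fun m q hm ha h1 h2 => ?_
      · simp only [SwivelCell] at hq
        omega
      · rcases m with _ | m <;>
          simp only [SwivelCell, TreeAdj, Option.some.injEq, reduceCtorEq, false_and, or_false,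
            false_or, true_and] at hm ha ⊢; omega
    · refine fin (-7) (some 0) (-4) (some 0) (-6) (by simp [SwivelCell, TreeAdj, TreeDistLE])
        (fun q hq hqr => ?_) fun m q hm ha h1 h2 => ?_
      · simp only [SwivelCell] at hq
        omega
      · rcases m with _ | m <;>
          simp only [SwivelCell, TreeAdj, Option.some.injEq, reduceCtorEq, false_and, or_false,
            false_or, true_and] at hm ha ⊢; omega
    · refine fin (-9) (some 0) (-8) (some (-2)) (-8) (by simp [SwivelCell, TreeAdj, TreeDistLE])
        (fun q hq hqr => ?_) fun m q hm ha h1 h2 => ?_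
      · simp only [SwivelCell] at hq
        omega
      · rcases m with _ | m <;>
          simp only [SwivelCell, TreeAdj, Option.some.injEq, reduceCtorEq, false_and, or_false,
            false_or, true_and] at hm ha ⊢; omega
    · simp only [SwivelCell] at hi'
      omega
    · refine fin (-2) (some (-1)) (-1) none (-1) (by simp [SwivelCell, TreeAdj, TreeDistLE])
        (fun q hq hqr => ?_) fun m q hm ha h1 h2 => ?_
      · simp only [SwivelCell] at hq
        omega
      · rcases m with _ | m <;>
          simp only [SwivelCell, TreeAdj, Option.some.injEq, reduceCtorEq, false_and, or_false,
            false_or, true_and] at hm ha ⊢ <;> omega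
    · refine fin (-4) (some (-1)) (-3) (some 1) (-3) (by simp [SwivelCell, TreeAdj, TreeDistLE]; omega)
        (fun q hq hqr => ?_) fun m q hm ha h1 h2 => ?_
      · simp only [SwivelCell] at hq
        omega
      · rcases m with _ | m <;>
          simp only [SwivelCell, TreeAdj, Option.some.injEq, reduceCtorEq, false_and, or_false,
            false_or, true_and] at hm ha ⊢ <;> omega
    · refine fin (-6) none (-5) (some 1) (-5) (by simp [SwivelCell, TreeAdj, TreeDistLE]; omega)
        (fun q hq hqr => ?_) fun m q hm ha h1 h2 => ?_
      · simp only [SwivelCell] at hq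
        omega
      · rcases m with _ | m <;>
          simp only [SwivelCell, TreeAdj, Option.some.injEq, reduceCtorEq, false_and, or_false,
            false_or, true_and] at hm ha ⊢ <;> omega
    · refine fin (-8) (some (-1)) (-7) (some 1) (-7) (by simp [SwivelCell, TreeAdj, TreeDistLE]; omega)
        (fun q hq hqr => ?_) fun m q hm ha h1 h2 => ?_
      · simp only [SwivelCell] at hq
        omega
      · rcases m with _ | m <;>
          simp only [SwivelCell, TreeAdj, Option.some.injEq, reduceCtorEq, false_and, or_false,
            false_or, true_and] at hm ha ⊢ <;> omega
    · refine fin (-10) (some (-1)) (-9) (some 1) (-9) (by simp [SwivelCell, TreeAdj, TreeDistLE])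
        (fun q hq hqr => ?_) fun m q hm ha h1 h2 => ?_
      · simp only [SwivelCell] at hq
        omega
      · rcases m with _ | m <;>
          simp only [SwivelCell, TreeAdj, Option.some.injEq, reduceCtorEq, false_and, or_false,
            false_or, true_and] at hm ha ⊢ <;> omega
    · simp only [SwivelCell] at hi'
      omega
    · exact ⟨_, _, _, _, _, SwivelLink.of_top hi h'⟩
    · have h2 : i ≤ l 1 + 3 := by
        simp only [SwivelCell] at hi'
        omega
      refine ⟨_, _, _, _, _, SwivelLink.of_arm hi (SwivelCell.arm hi (by omega)) ?_
        (SwivelCell.arm (by omega) (by omega)) ?_⟩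
      · rcases hi.eq_or_lt with rfl | hi
        · simp [SwivelCell]
        · exact SwivelCell.arm (by omega) (by omega)
      · simp only [SwivelCell]
        omega
    · have h2 : i ≤ l 2 + 2 := by
        simp only [SwivelCell] at hi'
        omega
      refine ⟨_, _, _, _, _, SwivelLink.of_arm hi (SwivelCell.arm hi (by omega)) ?_
        (SwivelCell.arm (by omega) (by omega)) ?_⟩
      · rcases hi.eq_or_lt with rfl | hi
        · simp [SwivelCell]
        · exact SwivelCell.arm (by omega) (by omega)
      · simp only [SwivelCell]
        omega
    · have h2 : i ≤ l 3 + 1 := by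
        simp only [SwivelCell] at hi'
        omega
      refine ⟨_, _, _, _, _, SwivelLink.of_arm hi (SwivelCell.arm hi (by omega)) ?_
        (SwivelCell.arm (by omega) (by omega)) ?_⟩
      · rcases hi.eq_or_lt with rfl | hi
        · simp [SwivelCell]
        · exact SwivelCell.arm (by omega) (by omega)
      · simp only [SwivelCell]
        omega
    · have h2 : i ≤ l 4 := by
        simp only [SwivelCell] at hi'
        omega
      refine ⟨_, _, _, _, _, SwivelLink.of_arm hi (SwivelCell.arm hi (by omega)) ?_
        (SwivelCell.arm (by omega) (by omega)) ?_⟩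
      · rcases hi.eq_or_lt with rfl | hi
        · simp [SwivelCell]
        · exact SwivelCell.arm (by omega) (by omega)
      · simp only [SwivelCell]
        omega
    · simp only [SwivelCell] at hi'
      omega

end SwivelModel

/-! ### The colouring of the model is minuscule. -/

section SwivelModel

variable {l : Fin 5 → ℕ}

namespace IsSwivelModel

variable {P : Type*} [PartialOrder P] {col : P → Option ℤ} {rk : P → ℤ}
  (M : IsSwivelModel l col rk)
include M

theorem ext {x y : P} (h1 : col x = col y) (h2 : rk x = rk y) : x = y := by
  apply le_antisymm <;> rw [M.le_iff, h1, h2, sub_self] <;> exact treeDistLE_self _ le_rfl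

theorem lt_iff {x y : P} : x < y ↔ TreeDistLE (col x) (col y) (rk y - rk x) ∧ rk x < rk y := by
  constructor
  · intro h
    have h1 := (M.le_iff x y).1 h.le
    refine ⟨h1, lt_of_le_of_ne (by linarith [h1.nonneg]) fun h2 => ?_⟩
    rw [h2, sub_self] at h1
    exact h.ne (M.ext h1.eq_of_zero h2)
  · rintro ⟨h1, h2⟩
    refine ((M.le_iff x y).2 h1).lt_of_ne ?_
    rintro rfl
    exact h2.ne rfl

theorem lt_of_adj {x y : P} (h : TreeAdj (col x) (col y)) (hr : rk x < rk y) : x < y :=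
  M.lt_iff.2 ⟨treeDistLE_one h (by omega), hr⟩

theorem lt_of_color_eq {x y : P} (h : col x = col y) (hr : rk x < rk y) : x < y :=
  M.lt_iff.2 ⟨h ▸ treeDistLE_self _ (by omega), hr⟩

theorem minusculeColoring (hl : Antitone l) : MinusculeColoring col TreeAdj where
  symm := treeAdj_symm
  irrefl i h := treeAdj_ne h rfl
  comparable_of_eq x y h := by
    rcases lt_trichotomy (rk x) (rk y) with hr | hr | hr
    · exact Or.inl (M.lt_of_color_eq h hr).le
    · exact Or.inl (M.ext h hr).le
    · exact Or.inr (M.lt_of_color_eq h.symm hr).le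
  comparable_of_adj x y h := by
    rcases lt_trichotomy (rk x) (rk y) with hr | hr | hr
    · exact Or.inl (M.lt_of_adj h hr).le
    · exact absurd hr ((M.mem x).ne_of_adj (M.mem y) h)
    · exact Or.inr (M.lt_of_adj (treeAdj_symm h) hr).le
  adj_of_covBy x y h := by
    have hlt := M.lt_iff.1 h.lt
    -- A cover cannot join equal colours, as a link element would lie in between; otherwise a
    -- neighbour of `x` of adjacent colour lies below `y`, and must be `y`.
    rcases (M.mem x).exists_between hl (M.mem y) hlt.1 hlt.2 with hc | ⟨k, hk, ha, hd⟩
    · obtain ⟨p, j, s, k, t, hL⟩ := (M.mem y).exists_link hl (hc ▸ M.mem x) hlt.2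
      obtain ⟨z, rfl, rfl⟩ := M.exists_mem _ _ hL.mem_left
      have hp := hL.max (rk x) (hc ▸ M.mem x) hlt.2
      exact absurd (M.lt_of_adj hL.adj_left hL.left.2)
        (h.2 (M.lt_of_adj (hc ▸ treeAdj_symm hL.adj_left) (hp.trans_lt hL.left.1)))
    · obtain ⟨z, rfl, hz⟩ := M.exists_mem _ _ hk
      rw [← hz] at hd
      have h1 := M.lt_of_adj ha (by omega)
      have h2 := (M.le_iff z y).2 hd
      rcases h2.eq_or_lt with rfl | h2
      · exact ha
      · exact absurd h2 (h.2 h1)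
  exists_pred x y hxy hc := by
    have hlt := M.lt_iff.1 hxy
    obtain ⟨p, j, s, k, t, hL⟩ := (M.mem y).exists_link hl (hc ▸ M.mem x) hlt.2
    obtain ⟨w, hwc, rfl⟩ := M.exists_mem _ _ hL.mem
    obtain ⟨u, rfl, rfl⟩ := M.exists_mem _ _ hL.mem_left
    obtain ⟨v, rfl, rfl⟩ := M.exists_mem _ _ hL.mem_right
    refine ⟨w, u, v, M.lt_of_color_eq hwc hL.lt, hwc, fun q hq hqc => ?_, ?_, fun q => ?_, ?_⟩
    · have := hL.max (rk q) (hqc ▸ M.mem q) (M.lt_iff.1 hq).2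
      rcases this.eq_or_lt with h | h
      · exact (M.ext (hqc.trans hwc.symm) h).le
      · exact (M.lt_of_color_eq (hqc.trans hwc.symm) h).le
    · rintro rfl
      exact hL.ne.elim (fun h => h rfl) fun h => h rfl
    · rw [hwc]
      constructor
      · rintro ⟨h1, h2, h3⟩
        exact (hL.eq_or_eq _ _ (M.mem q) h3 (M.lt_iff.1 h1).2 (M.lt_iff.1 h2).2).imp
          (fun h => M.ext h.1 h.2) fun h => M.ext h.1 h.2
      · rintro (rfl | rfl)
        · exact ⟨M.lt_of_adj (hwc ▸ treeAdj_symm hL.adj_left) hL.left.1,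
            M.lt_of_adj hL.adj_left hL.left.2, hL.adj_left⟩
        · exact ⟨M.lt_of_adj (hwc ▸ treeAdj_symm hL.adj_right) hL.right.1,
            M.lt_of_adj hL.adj_right hL.right.2, hL.adj_right⟩
    · rw [M.le_iff, M.le_iff]
      exact hL.color
  eq_of_top x hx u v hu hv hau hav := by
    have htop : ∀ r, SwivelCell l (col x) r → r ≤ rk x := by
      intro r hr
      obtain ⟨z, hzc, rfl⟩ := M.exists_mem _ _ hr
      by_contra hcon
      exact hx z (M.lt_of_color_eq hzc.symm (not_le.1 hcon)) hzc
    obtain ⟨h1, h2⟩ := (M.mem x).eq_of_top hl htop (M.mem u) (M.mem v) hau hav (M.lt_iff.1 hu).2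
      (M.lt_iff.1 hv).2
    exact M.ext h1 h2
  eq_of_bot p hp x hxp hx u v hxu hup hxv hvp hau hav := by
    have hbot : ∀ r, SwivelCell l (col p) r → rk p ≤ r := by
      intro r hr
      obtain ⟨z, hzc, rfl⟩ := M.exists_mem _ _ hr
      by_contra hcon
      exact hp z (M.lt_of_color_eq hzc (not_le.1 hcon)) hzc
    -- Slack would give another element of the colour of `x` two ranks higher and still below `p`.
    -- So chains up to `p` follow shortest paths, whose next colour is determined.
    have htight : ¬ TreeDistLE (col x) (col p) (rk p - rk x - 1) := by
      intro h
      have h2 := (M.mem x).treeDistLE_sub_two (M.mem p) h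
      have h3 := (M.mem x).exists_of_slack hl (M.mem p) hbot (hp x hxp) h2
      obtain ⟨z, hzc, hz⟩ := M.exists_mem _ _ h3
      refine hx z (M.lt_of_color_eq hzc.symm (by omega)) ((M.le_iff z p).2 ?_) hzc
      rw [hzc, hz, ← sub_sub]
      exact h2
    have := eq_of_tight htight hau hav (sub_pos.2 (M.lt_iff.1 hxu).2)
      (sub_pos.2 (M.lt_iff.1 hxv).2)
      (by rw [sub_sub_sub_cancel_right]; exact (M.le_iff u p).1 hup)
      (by rw [sub_sub_sub_cancel_right]; exact (M.le_iff v p).1 hvp)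
    exact M.ext this.1 (by linarith [this.2])
  no_square := treeAdj_no_square
  degree := ⟨some 0, treeAdj_degree_two, treeAdj_degree_three⟩

end IsSwivelModel

end SwivelModel

/-! ### Coordinates on the glued poset. -/

section SwivelModel

variable {l : Fin 5 → ℕ}

/-- The colours of the elements of the swivel. -/
def swivelColor (l : Fin 5 → ℕ) (hl : Antitone l) : Swivel l hl → Option ℤ
  | .diag _ => some 0
  | .cell i u => ![some ((u.2 : ℤ) - (u.1 : ℕ)), some ((u.1 : ℕ) - (u.2 : ℤ)), none,
      some ((u.1 : ℕ) - (u.2 : ℤ)), none] i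
  | .above j => some ((j : ℕ) + 1)

/-- The ranks of the elements of the swivel. -/
def swivelRank (l : Fin 5 → ℕ) (hl : Antitone l) : Swivel l hl → ℤ
  | .diag a => 2 * (a : ℕ) - 10
  -- The constants make the rank formula at `(r, r)` agree with the rank of the diagonal entry glued
  -- there: the diagonal cell `(0, 0)` is `x_5, x_3, x_4, x_6, x_6` respectively.
  | .cell i u => -((u.1 : ℕ) + (u.2 : ℤ)) - ![2, 6, 4, 0, 0] i
  | .above j => (j : ℕ) + 1

theorem swivelPieces_level (hl : Antitone l) (i : Fin 5) (r : ℕ) :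
    (swivelPieces l hl i).level r = ![5, 3, 4, 6, 6] i - r := by
  fin_cases i <;> change _ + _ - (r + 1) = _ - r
  · change 1 + 5 - (r + 1) = 5 - r
    omega
  · change 1 + 3 - (r + 1) = 3 - r
    omega
  · change 3 + 2 - (r + 1) = 4 - r
    omega
  · change 4 + 3 - (r + 1) = 6 - r
    omega
  · change 5 + 2 - (r + 1) = 6 - r
    omega

theorem swivelPieces_len (hl : Antitone l) (i : Fin 5) :
    (swivelPieces l hl i).len = ![5, 3, 2, 3, 2] i := by
  fin_cases i <;> rfl

theorem swivel_cell_lt (hl : Antitone l) (i : Fin 5) (u : (swivelPieces l hl i).OffDiag) :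
    u.1.val < ![5, 3, 2, 3, 2] i ∧ u.1.val < u.2.val ∧
      (i ≠ 0 → u.2.val < ![5, 3, 2, 3, 2] i) := by
  obtain ⟨r, c, hc⟩ := u
  have hr := r.2
  rw [Finset.mem_Ioo] at hc
  refine ⟨hr.trans_eq (swivelPieces_len hl i), hc.1, fun hi => ?_⟩
  have h2 := hc.2
  fin_cases i
  exacts [absurd rfl hi, h2, h2, h2, h2]

/-- In one shifted diagram the order is the light cone order for colour `±(c - r)` and rank `-(r +
c)`, up to a constant. Between pieces on different branches the tree path passes through colour
`some 0`, which matches comparison through a diagonal entry. Two pieces on the same short branch are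
so far apart in rank that all their cells are comparable on both sides. -/
theorem isSwivelModel (hl : Antitone l) :
    IsSwivelModel l (swivelColor l hl) (swivelRank l hl) where
  le_iff x y := by
    rcases x with a | ⟨i, u⟩ | j <;> rcases y with a' | ⟨i', u'⟩ | j'
    · change a ≤ a' ↔ _
      simp only [swivelColor, swivelRank, TreeDistLE, Fin.le_def]
      omega
    · have h := swivel_cell_lt hl i' u'
      change (u'.2.val < (swivelPieces l hl i').len ∧
        a.val + 1 ≤ (swivelPieces l hl i').level u'.2.val) ↔ _
      rw [swivelPieces_level]
      simp only [swivelColor, swivelRank]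
      generalize u'.2.val = c' at *
      generalize u'.1.val = r' at *
      clear u'
      rw [swivelPieces_len]
      fin_cases i' <;> simp [TreeDistLE] at h ⊢ <;> omega
    · change True ↔ _
      simp only [swivelColor, swivelRank, TreeDistLE, true_iff]
      omega
    · have h := swivel_cell_lt hl i u
      change (swivelPieces l hl i).level u.1.val ≤ a'.val + 1 ↔ _
      rw [swivelPieces_level]
      simp only [swivelColor, swivelRank]
      generalize u.2.val = c at *
      generalize u.1.val = r at *
      clear u
      fin_cases i <;> simp [TreeDistLE] at h ⊢ <;> omega
    · have h := swivel_cell_lt hl i u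
      have h' := swivel_cell_lt hl i' u'
      change ((i = i' ∧ u'.1.val ≤ u.1.val ∧ u'.2.val ≤ u.2.val) ∨
        (u'.2.val < (swivelPieces l hl i').len ∧
          (swivelPieces l hl i).level u.1.val ≤ (swivelPieces l hl i').level u'.2.val)) ↔ _
      rw [swivelPieces_level, swivelPieces_level]
      simp only [swivelColor, swivelRank]
      generalize u.2.val = c at *
      generalize u.1.val = r at *
      generalize u'.2.val = c' at *
      generalize u'.1.val = r' at *
      clear u u'
      rw [swivelPieces_len]
      fin_cases i <;> fin_cases i' <;> simp [TreeDistLE] at h h' ⊢ <;> omega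
    · have h := swivel_cell_lt hl i u
      change True ↔ _
      simp only [swivelColor, swivelRank]
      generalize u.2.val = c at *
      generalize u.1.val = r at *
      clear u
      fin_cases i <;> simp [TreeDistLE] at h ⊢ <;> omega
    · change False ↔ _
      simp only [swivelColor, swivelRank, TreeDistLE, false_iff]
      omega
    · have h := swivel_cell_lt hl i' u'
      change False ↔ _
      simp only [swivelColor, swivelRank]
      generalize u'.2.val = c' at *
      generalize u'.1.val = r' at *
      clear u'
      fin_cases i' <;> simp [TreeDistLE] at h ⊢ <;> omega
    · change j ≤ j' ↔ _
      simp only [swivelColor, swivelRank, TreeDistLE, Fin.le_def]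
      omega
  mem x := by
    rcases x with a | ⟨i, u⟩ | j
    · refine Or.inr (Or.inr (Or.inl ⟨rfl, ?_⟩))
      simp only [swivelRank]
      omega
    · have h := swivel_cell_lt hl i u
      have h0 : i = 0 → ∃ r : Fin 5, u.1.val = r.val ∧ u.2.val < 5 + l r := by
        rintro rfl
        exact ⟨u.1, rfl, (Finset.mem_Ioo.1 u.2.2).2⟩
      simp only [swivelColor, swivelRank]
      generalize u.2.val = c at *
      generalize u.1.val = r at *
      clear u
      fin_cases i
      · obtain ⟨r', rfl, hr'⟩ := h0 rfl
        refine SwivelCell.arm ?_ ?_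
        · simp at h ⊢
          omega
        · fin_cases r' <;> simp at h hr' ⊢ <;> omega
      all_goals
        simp [SwivelCell] at h ⊢
        omega
    · exact SwivelCell.arm (by omega) (Or.inl ⟨rfl, by omega⟩)
  exists_mem i r h := by
    have cell : ∀ (i : Fin 5) (r : Fin (swivelPieces l hl i).len) (c : ℕ), r.val < c →
        c < (swivelPieces l hl i).len + (swivelPieces l hl i).shape.2 r →
        ∃ x : Swivel l hl, swivelColor l hl x = ![some ((c : ℤ) - (r : ℕ)),
          some ((r : ℕ) - (c : ℤ)), none, some ((r : ℕ) - (c : ℤ)), none] i ∧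
          swivelRank l hl x = -((r : ℕ) + (c : ℤ)) - ![2, 6, 4, 0, 0] i := fun i r c h1 h2 =>
      ⟨.cell i ⟨r, c, Finset.mem_Ioo.2 ⟨h1, h2⟩⟩, rfl, rfl⟩
    rcases i with _ | i
    · rcases h with rfl | rfl
      · exact cell 4 (0 : Fin 2) 1 (show 0 < 1 by decide) (show 1 < 2 by decide)
      · exact cell 2 (0 : Fin 2) 1 (show 0 < 1 by decide) (show 1 < 2 by decide)
    rcases h with ⟨rfl, rfl | rfl⟩ | ⟨rfl, rfl | rfl | rfl | rfl⟩ | ⟨rfl, h⟩ |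
      ⟨hi, ⟨rfl, h⟩ | ⟨rfl, h⟩ | ⟨rfl, h⟩ | ⟨rfl, h⟩ | ⟨rfl, h⟩ | ⟨rfl, h⟩⟩
    · exact cell 3 (0 : Fin 3) 2 (show 0 < 2 by decide) (show 2 < 3 by decide)
    · exact cell 1 (0 : Fin 3) 2 (show 0 < 2 by decide) (show 2 < 3 by decide)
    · exact cell 3 (0 : Fin 3) 1 (show 0 < 1 by decide) (show 1 < 3 by decide)
    · exact cell 3 (1 : Fin 3) 2 (show 1 < 2 by decide) (show 2 < 3 by decide)
    · exact cell 1 (0 : Fin 3) 1 (show 0 < 1 by decide) (show 1 < 3 by decide)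
    · exact cell 1 (1 : Fin 3) 2 (show 1 < 2 by decide) (show 2 < 3 by decide)
    · refine ⟨.diag ⟨((r + 10) / 2).toNat, by omega⟩, rfl, ?_⟩
      simp only [swivelRank]
      omega
    · refine ⟨.above ⟨(r - 1).toNat, by omega⟩, ?_, ?_⟩ <;>
        simp only [swivelRank, swivelColor, Option.some.injEq] <;> omega
    -- In row `r` of the diagram, colour `i` sits in column `i + r`.
    · obtain ⟨x, h1, h2⟩ := cell 0 (0 : Fin 5) (i.toNat + 0) (by change 0 < _; omega) (by change _ < 5 + l 0; omega)
      refine ⟨x, h1.trans ?_, h2.trans ?_⟩ <;> simp <;> omega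
    · obtain ⟨x, h1, h2⟩ := cell 0 (1 : Fin 5) (i.toNat + 1) (by change 1 < _; omega) (by change _ < 5 + l 1; omega)
      refine ⟨x, h1.trans ?_, h2.trans ?_⟩ <;> simp <;> omega
    · obtain ⟨x, h1, h2⟩ := cell 0 (2 : Fin 5) (i.toNat + 2) (by change 2 < _; omega) (by change _ < 5 + l 2; omega)
      refine ⟨x, h1.trans ?_, h2.trans ?_⟩ <;> simp <;> omega
    · obtain ⟨x, h1, h2⟩ := cell 0 (3 : Fin 5) (i.toNat + 3) (by change 3 < _; omega) (by change _ < 5 + l 3; omega)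
      refine ⟨x, h1.trans ?_, h2.trans ?_⟩ <;> simp <;> omega
    · obtain ⟨x, h1, h2⟩ := cell 0 (4 : Fin 5) (i.toNat + 4) (by change 4 < _; omega) (by change _ < 5 + l 4; omega)
      refine ⟨x, h1.trans ?_, h2.trans ?_⟩ <;> simp <;> omega

end SwivelModel

theorem mainTheorem8 (lam : Fin 5 → ℕ) (hlam : Antitone lam) :
    IsDComplete (Swivel lam hlam) ∧ HookLengthProperty (Swivel lam hlam) :=
  have H := (isSwivelModel hlam).minusculeColoring hlam
  ⟨H.isDComplete, H.hookLengthProperty⟩
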